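/- **Setting.** A Garside structure $(B,B^+,\Delta)$ (of finite type) on a group $B$ is a submonoid $B^+$ (the positive elements) generating $B$ and an element $\Delta\in B^+$ such that: the relations $a\preccurlyeq b\iff a^{-1}b\in B^+$ (prefix) and $b\succcurlyeq c\iff bc^{-1}\in B^+$ (suffix) are lattice orders on $B$; $\Delta$ is balanced; the set $\operatorname{Div}(\Delta)$ of simple elements is finite and generates the monoid $B^+$; and the number of factors in a decomposition of a given positive element into nontrivial positive elements is bounded. Here $\operatorname{Div}(\delta)=\{a : 1\preccurlyeq a\preccurlyeq\delta\}$, and $\delta\in B^+$ is balanced if $\operatorname{Div}(\delta)=\{a:\delta\succcurlyeq a\succcurlyeq 1\}$. The set $\mathcal A$ of atoms consists of the simple elements $\ne 1$ with no proper nontrivial positive prefix. Write $H^g=g^{-1}Hg$ and $x^g=g^{-1}xg$. For a balanced simple element $\delta$, let $B_\delta=\langle \operatorname{Div}(\delta)\cap\mathcal A\rangle$; it is a standard parabolic subgroup if $\operatorname{Div}(\delta)=\operatorname{Div}(\Delta)\cap B_\delta\cap B^+$. A parabolic subgroup is a conjugate of a standard parabolic subgroup. The parabolic closure $\mathrm{PC}(x)$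 of $x\in B$ is the smallest (for inclusion) parabolic subgroup containing $x$. For $X\subset\mathcal A$ let $\Delta_X$ be the join of $X$ for $\preccurlyeq$ ($\Delta_\varnothing=1$), $\overline X=\operatorname{Div}(\Delta_X)\cap\mathcal A$ and $B_X=B_{\Delta_X}$. The structure is LCM-Garside if $\Delta=\Delta_{\mathcal A}$ and, for every $X\subset\mathcal A$, $\Delta_X$ is balanced and $B_X=B_{\Delta_X}$ is a standard parabolic subgroup. Every $x\in B$ is uniquely $x=a^{-1}b$ with $a,b\in B^+$ and $a\wedge b=1$. In the LCM-Garside case, $\operatorname{Supp}(x)=\overline X$, where $X$ is the set of atoms occurring in some words in the atoms for $a$ and $b$ (this is independent of the words). The structure is support-preserving if $(B_{\operatorname{Supp}(y)})^\alpha=B_{\operatorname{Supp}(z)}$ whenever $y,z\in B^+$, $\alpha\in B$ and $y^\alpha=z$. The swap of $x=a^{-1}b$ is $ba^{-1}$; $x$ is recurrent if some positive iterate of the swap fixes $x$. Relations are homogeneous if any two words in the atoms representing the same positive element $x$ have the same length, denoted $|x|$; simple elements are squarefree if $aa$ is not simple for every atom $a$. For $\gamma\in B$ let $\varphi(\gamma)=|\Delta_U|$,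 where $U=\operatorname{Supp}(\gamma')$ for a recurrent conjugate $\gamma'$ of $\gamma$ (this exists, and $\varphi(\gamma)$ does not depend on its choice, under the assumptions of the theorem). **Theorem.** Let $(B,B^+,\Delta)$ be a support-preserving LCM-Garside structure with homogeneous relations and squarefree simple elements, and let $B_1,B_2$ be parabolic subgroups of $B$. Then $B_1\cap B_2$ is a parabolic subgroup. More precisely, $\varphi$ attains a maximum on $B_1\cap B_2$, and $B_1\cap B_2=\mathrm{PC}(\alpha)$ for every $\alpha\in B_1\cap B_2$ at which $\varphi$ is maximal. -/

import Mathlib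

/-- `r` is a lattice order: a partial order in which any two elements have a meet (greatest
lower bound) and a join (least upper bound). -/
def IsLatticeOrder {G : Type*} (r : G → G → Prop) : Prop :=
  (∀ a, r a a) ∧ (∀ a b c, r a b → r b c → r a c) ∧ (∀ a b, r a b → r b a → a = b) ∧
  (∀ a b, ∃ m, r m a ∧ r m b ∧ ∀ c, r c a → r c b → r c m) ∧
  (∀ a b, ∃ m, r a m ∧ r b m ∧ ∀ c, r a c → r b c → r m c)

/-- A Garside structure `(G, G⁺, Δ)` (of finite type) on the group `G`. -/
structure GarsideStructure (G : Type*) [Group G] where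
  /-- the monoid `G⁺` of positive elements -/
  pos : Submonoid G
  /-- the Garside element `Δ` -/
  Delta : G
  Delta_pos : Delta ∈ pos
  /-- `a ≼ b` (`a` is a prefix of `b`), meaning `a⁻¹ b ∈ G⁺`, is a lattice order on `G`. -/
  prefix_lattice : IsLatticeOrder (fun a b : G => a⁻¹ * b ∈ pos)
  /-- `b ≽ c` (`c` is a suffix of `b`), meaning `b c⁻¹ ∈ G⁺`, is a lattice order on `G`. -/
  suffix_lattice : IsLatticeOrder (fun c b : G => b * c⁻¹ ∈ pos)
  /-- `Δ` is balanced: its positive prefixes are its positive suffixes. -/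
  Delta_balanced : {a : G | a ∈ pos ∧ a⁻¹ * Delta ∈ pos} = {a : G | a ∈ pos ∧ Delta * a⁻¹ ∈ pos}
  /-- There are finitely many simple elements. -/
  simples_finite : {a : G | a ∈ pos ∧ a⁻¹ * Delta ∈ pos}.Finite
  /-- The simple elements generate the monoid `G⁺`. -/
  simples_generate : Submonoid.closure {a : G | a ∈ pos ∧ a⁻¹ * Delta ∈ pos} = pos
  /-- `G⁺` generates the group `G`. -/
  pos_generate : Subgroup.closure (pos : Set G) = ⊤
  /-- Atomicity: the number of factors in a decomposition of a positive element as a product of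
  nontrivial positive elements is bounded. -/
  atomic : ∀ x ∈ pos, ∃ N : ℕ, ∀ l : List G, (∀ y ∈ l, y ∈ pos ∧ y ≠ 1) → l.prod = x → l.length ≤ N

/-- The conjugate `H ^ g = g⁻¹ H g` of a subgroup. -/
def conjSubgroup {G : Type*} [Group G] (H : Subgroup G) (g : G) : Subgroup G :=
  H.map (MulAut.conj g⁻¹).toMonoidHom

namespace GarsideStructure

variable {G : Type*} [Group G] (𝒢 : GarsideStructure G)

/-- `a ≼ b`: `a` is a prefix of `b`. -/
def Prefix (a b : G) : Prop := a⁻¹ * b ∈ 𝒢.pos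

/-- `b ≽ c`: `c` is a suffix of `b`. -/
def Suffix (c b : G) : Prop := b * c⁻¹ ∈ 𝒢.pos

/-- `Div δ = {a | 1 ≼ a ≼ δ}`. -/
def divisors (δ : G) : Set G := {a | 𝒢.Prefix 1 a ∧ 𝒢.Prefix a δ}

/-- A positive element is balanced if its positive prefixes are its positive suffixes. -/
def Balanced (δ : G) : Prop :=
  δ ∈ 𝒢.pos ∧ 𝒢.divisors δ = {a | 𝒢.Suffix 1 a ∧ 𝒢.Suffix a δ}

/-- The simple elements. -/
def simples : Set G := 𝒢.divisors 𝒢.Delta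

/-- The atoms: nontrivial simple elements without proper nontrivial prefixes. -/
def atoms : Set G :=
  {a | a ∈ 𝒢.simples ∧ a ≠ 1 ∧ ∀ b, 𝒢.Prefix 1 b → 𝒢.Prefix b a → b = 1 ∨ b = a}

/-! ### Parabolic subgroups -/

/-- The subgroup `G_δ` generated by the atoms dividing `δ` (for a balanced `δ`). -/
def parabolicOf (δ : G) : Subgroup G := Subgroup.closure (𝒢.divisors δ ∩ 𝒢.atoms)

/-- `δ` is a balanced simple element for which `G_δ` is a standard parabolic subgroup:
`Div δ = Div Δ ∩ G_δ⁺`, where `G_δ⁺ = G_δ ∩ G⁺`. -/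
def DefinesStandard (δ : G) : Prop :=
  𝒢.Balanced δ ∧ δ ∈ 𝒢.simples ∧
    𝒢.divisors δ = 𝒢.simples ∩ ((𝒢.parabolicOf δ : Set G) ∩ (𝒢.pos : Set G))

/-- Standard parabolic subgroups. -/
def IsStandardParabolic (H : Subgroup G) : Prop :=
  ∃ δ, 𝒢.DefinesStandard δ ∧ H = 𝒢.parabolicOf δ

/-- Parabolic subgroups: the conjugates of standard parabolic subgroups. -/
def IsParabolic (P : Subgroup G) : Prop :=
  ∃ H g, 𝒢.IsStandardParabolic H ∧ P = conjSubgroup H g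

/-- `P` is the parabolic closure of `x`: the smallest parabolic subgroup containing `x`. -/
def IsParabolicClosure (x : G) (P : Subgroup G) : Prop :=
  IsLeast {Q : Subgroup G | 𝒢.IsParabolic Q ∧ x ∈ Q} P

/-! ### LCM-Garside structures -/

/-- `d` is the join for `≼` of the set `X` of positive elements. Only positive upper bounds are
compared; this changes nothing for nonempty `X`, and it makes `1` the join of the empty set. -/
def IsJoin (X : Set G) (d : G) : Prop :=
  d ∈ 𝒢.pos ∧ (∀ x ∈ X, 𝒢.Prefix x d) ∧ ∀ c ∈ 𝒢.pos, (∀ x ∈ X, 𝒢.Prefix x c) → 𝒢.Prefix d c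

/-- `Δ_X`, the join of a set `X` of atoms (see `isJoin_deltaOf`). -/
noncomputable def deltaOf (X : Set G) : G := Classical.epsilon (𝒢.IsJoin X)

/-- LCM-Garside structures. -/
structure IsLCM : Prop where
  Delta_eq : 𝒢.Delta = 𝒢.deltaOf 𝒢.atoms
  balanced : ∀ X ⊆ 𝒢.atoms, 𝒢.Balanced (𝒢.deltaOf X)
  standard : ∀ X ⊆ 𝒢.atoms, 𝒢.DefinesStandard (𝒢.deltaOf X)

/-- The closure `Div Δ_X ∩ 𝒜` of a set `X` of atoms. -/
noncomputable def atomClosure (X : Set G) : Set G := 𝒢.divisors (𝒢.deltaOf X) ∩ 𝒢.atoms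

/-! ### Words, fractions, supports -/

/-- `l` is a word in the atoms representing `x`. -/
def IsAtomWord (x : G) (l : List G) : Prop := (∀ a ∈ l, a ∈ 𝒢.atoms) ∧ l.prod = x

/-- A word in the atoms representing the positive element `x` (see `isAtomWord_atomWord`). -/
noncomputable def atomWord (x : G) : List G := Classical.epsilon (𝒢.IsAtomWord x)

/-- `x = a⁻¹ b` is the reduced left-fraction decomposition of `x`: `a`, `b` are positive and
`a ∧ b = 1`. -/
def IsReducedFraction (x : G) (p : G × G) : Prop :=
  p.1 ∈ 𝒢.pos ∧ p.2 ∈ 𝒢.pos ∧ x = p.1⁻¹ * p.2 ∧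
    ∀ c, 𝒢.Prefix c p.1 → 𝒢.Prefix c p.2 → 𝒢.Prefix c 1

/-- The pair (left-denominator, left-numerator) of `x` (see `isReducedFraction_fraction`). -/
noncomputable def fraction (x : G) : G × G := Classical.epsilon (𝒢.IsReducedFraction x)

/-- The left-denominator `D_L(x)`. -/
noncomputable def leftDen (x : G) : G := (𝒢.fraction x).1

/-- The left-numerator `N_L(x)`. -/
noncomputable def leftNum (x : G) : G := (𝒢.fraction x).2

/-- The support of `x`: the closure of the set of atoms occurring in words for the left-denominator
and the left-numerator of `x`. In an LCM-Garside structure it does not depend on the words. -/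
noncomputable def support (x : G) : Set G :=
  𝒢.atomClosure {a | a ∈ 𝒢.atomWord (𝒢.leftDen x) ∨ a ∈ 𝒢.atomWord (𝒢.leftNum x)}

/-- The subgroup `G_X = G_{Δ_X}` attached to a set `X` of atoms. -/
noncomputable def subgroupOfAtoms (X : Set G) : Subgroup G := 𝒢.parabolicOf (𝒢.deltaOf X)

/-- Support-preserving structures: if `y`, `z` are positive and `y ^ α = z`, then
`(G_{Supp y}) ^ α = G_{Supp z}`. -/
def IsSupportPreserving : Prop :=
  ∀ y ∈ 𝒢.pos, ∀ z ∈ 𝒢.pos, ∀ α : G, α⁻¹ * y * α = z →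
    conjSubgroup (𝒢.subgroupOfAtoms (𝒢.support y)) α = 𝒢.subgroupOfAtoms (𝒢.support z)

/-- Homogeneous relations: two words in the atoms that represent the same element have the same
length. -/
def IsHomogeneous : Prop :=
  ∀ (x : G) (l l' : List G), 𝒢.IsAtomWord x l → 𝒢.IsAtomWord x l' → l.length = l'.length

/-- Simple elements are square-free: `a a` is not simple, for every atom `a`. -/
def IsSquarefree : Prop := ∀ a ∈ 𝒢.atoms, a * a ∉ 𝒢.simples

/-- The length `|x|` of a positive element as a word in the atoms. -/
noncomputable def length (x : G) : ℕ := (𝒢.atomWord x).length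

/-! ### Swaps, recurrent elements, and the function maximized by the intersection -/

/-- The swap, sending `x = a⁻¹ b` (reduced left-fraction) to `b a⁻¹`. -/
noncomputable def swap (x : G) : G := 𝒢.leftNum x * (𝒢.leftDen x)⁻¹

/-- Recurrent elements (for swap). -/
def IsRecurrent (x : G) : Prop := ∃ m : ℕ, 0 < m ∧ 𝒢.swap^[m] x = x

/-- The set `R(x)` of recurrent conjugates of `x`. -/
def recurrentConjugates (x : G) : Set G := {y | IsConj x y ∧ 𝒢.IsRecurrent y}

/-- `φ(γ) = |Δ_U|` where `U` is the support of a recurrent conjugate of `γ`. -/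
noncomputable def phi (γ : G) : ℕ :=
  𝒢.length (𝒢.deltaOf (𝒢.support (Classical.epsilon (fun y => y ∈ 𝒢.recurrentConjugates γ))))

/-! ### The choices above are made among existing objects -/

theorem eq_one_of_mem_of_inv_mem {x : G} (h : x ∈ 𝒢.pos) (h' : x⁻¹ ∈ 𝒢.pos) : x = 1 :=
  𝒢.prefix_lattice.2.2.1 x 1 (by simpa using h') (by simpa using h)

theorem isReducedFraction_fraction (x : G) : 𝒢.IsReducedFraction x (𝒢.fraction x) := by
  apply Classical.epsilon_spec (p := 𝒢.IsReducedFraction x)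
  obtain ⟨m, h1, h2, h3⟩ := 𝒢.prefix_lattice.2.2.2.1 1 x
  refine ⟨(m⁻¹, m⁻¹ * x), by simpa using h1, by simpa using h2, by simp, ?_⟩
  intro c hc hd
  have := h3 (m * c) (by simpa [Prefix, mul_assoc] using hc)
    (by simpa [Prefix, mul_assoc] using hd)
  simpa [Prefix, mul_assoc] using this

theorem fraction_unique {x : G} {p q : G × G} (hp : 𝒢.IsReducedFraction x p)
    (hq : 𝒢.IsReducedFraction x q) : p = q := by
  have key : ∀ p q : G × G, 𝒢.IsReducedFraction x p → 𝒢.IsReducedFraction x q →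
      q.1 * p.1⁻¹ ∈ 𝒢.pos := by
    rintro ⟨a, b⟩ ⟨c, d⟩ ⟨ha, hb, hx, hm⟩ ⟨hc, hd, hx', -⟩
    simp only at *
    have hd' : d = c * a⁻¹ * b := by
      rw [hx] at hx'
      rw [mul_assoc, hx']
      group
    have := hm (a * c⁻¹) (by simpa [Prefix] using hc)
      (by simpa [Prefix, mul_assoc, hd'] using hd)
    simpa [Prefix] using this
  have h := 𝒢.eq_one_of_mem_of_inv_mem (key p q hp hq) (by simpa using key q p hq hp)
  have h1 : q.1 = p.1 := by simpa [mul_inv_eq_one] using h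
  have h2 : p.1⁻¹ * p.2 = q.1⁻¹ * q.2 := hp.2.2.1.symm.trans hq.2.2.1
  rw [h1] at h2
  exact Prod.ext h1.symm (mul_left_cancel h2)

theorem exists_isAtomWord {x : G} (hx : x ∈ 𝒢.pos) : ∃ l, 𝒢.IsAtomWord x l := by
  have happ : ∀ x y : G, (∃ l, 𝒢.IsAtomWord x l) → (∃ l, 𝒢.IsAtomWord y l) →
      ∃ l, 𝒢.IsAtomWord (x * y) l := by
    rintro x y ⟨l, h1, h2⟩ ⟨l', h3, h4⟩
    refine ⟨l ++ l', ?_, by simp [h2, h4]⟩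
    intro a ha
    rcases List.mem_append.1 ha with h | h
    · exact h1 a h
    · exact h3 a h
  have hsimple : ∀ N : ℕ, ∀ s ∈ 𝒢.simples,
      (∀ l : List G, (∀ y ∈ l, y ∈ 𝒢.pos ∧ y ≠ 1) → l.prod = s → l.length ≤ N) →
      ∃ l, 𝒢.IsAtomWord s l := by
    intro N
    induction N using Nat.strong_induction_on with
    | _ N ih =>
      intro s hs hN
      by_cases h1 : s = 1
      · exact ⟨[], by simp, by simp [h1]⟩
      by_cases hat : s ∈ 𝒢.atoms
      · exact ⟨[s], by simpa using hat, by simp⟩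
      have : ∃ b, 𝒢.Prefix 1 b ∧ 𝒢.Prefix b s ∧ b ≠ 1 ∧ b ≠ s := by
        by_contra hcon
        refine hat ⟨hs, h1, fun b hb hb' => ?_⟩
        by_contra h
        push Not at h
        exact hcon ⟨b, hb, hb', h.1, h.2⟩
      obtain ⟨b, hb, hbs, hb1, hbs'⟩ := this
      have hbp : b ∈ 𝒢.pos := by simpa [Prefix] using hb
      set c := b⁻¹ * s with hc
      have hcp : c ∈ 𝒢.pos := hbs
      have hc1 : c ≠ 1 := by
        intro h
        exact hbs' (inv_mul_eq_one.1 h)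
      have hsb : s = b * c := by simp [hc]
      have hsD : s⁻¹ * 𝒢.Delta ∈ 𝒢.pos := hs.2
      have hbS : b ∈ 𝒢.simples := ⟨hb, by
        have := 𝒢.pos.mul_mem hbs hsD
        simpa [Prefix, mul_assoc] using this⟩
      have hsp : s ∈ 𝒢.pos := by simpa [Prefix] using hs.1
      have hcS : c ∈ 𝒢.simples := by
        have hs' : s ∈ {a : G | a ∈ 𝒢.pos ∧ 𝒢.Delta * a⁻¹ ∈ 𝒢.pos} := by
          rw [← 𝒢.Delta_balanced]; exact ⟨hsp, hsD⟩
        have : c ∈ {a : G | a ∈ 𝒢.pos ∧ a⁻¹ * 𝒢.Delta ∈ 𝒢.pos} := by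
          rw [𝒢.Delta_balanced]
          refine ⟨hcp, ?_⟩
          have := 𝒢.pos.mul_mem hs'.2 hbp
          simpa [hsb, mul_assoc] using this
        exact ⟨by simpa [Prefix] using hcp, this.2⟩
      have hN1 : 1 ≤ N := by
        have := hN [s] (by simpa using ⟨hsp, h1⟩) (by simp)
        simpa using this
      have hb' := ih (N - 1) (by omega) b hbS (fun l hl hlp => by
        have := hN (l ++ [c]) (by
          intro y hy
          rcases List.mem_append.1 hy with h | h
          · exact hl y h
          · rw [List.mem_singleton.1 h]; exact ⟨hcp, hc1⟩) (by simp [hlp, hsb])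
        simp at this
        omega)
      have hc' := ih (N - 1) (by omega) c hcS (fun l hl hlp => by
        have := hN (b :: l) (by
          intro y hy
          rcases List.mem_cons.1 hy with h | h
          · rw [h]; exact ⟨hbp, hb1⟩
          · exact hl y h) (by simp [hlp, hsb])
        simp at this
        omega)
      rw [hsb]
      exact happ b c hb' hc'
  rw [← 𝒢.simples_generate] at hx
  induction hx using Submonoid.closure_induction with
  | mem s hs =>
    obtain ⟨N, hN⟩ := 𝒢.atomic s hs.1
    exact hsimple N s ⟨by simpa [Prefix] using hs.1, hs.2⟩ hN
  | one => exact ⟨[], by simp, by simp⟩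
  | mul x y _ _ h1 h2 => exact happ x y h1 h2

theorem isAtomWord_atomWord {x : G} (hx : x ∈ 𝒢.pos) : 𝒢.IsAtomWord x (𝒢.atomWord x) :=
  Classical.epsilon_spec (p := 𝒢.IsAtomWord x) (𝒢.exists_isAtomWord hx)

theorem isJoin_deltaOf {X : Set G} (hX : X ⊆ 𝒢.atoms) : 𝒢.IsJoin X (𝒢.deltaOf X) := by
  apply Classical.epsilon_spec (p := 𝒢.IsJoin X)
  have hfin : X.Finite := 𝒢.simples_finite.subset (fun a ha =>
    ⟨by simpa [Prefix] using (hX ha).1.1, (hX ha).1.2⟩)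
  clear hX
  induction X, hfin using Set.Finite.induction_on with
  | empty => exact ⟨1, 𝒢.pos.one_mem, by simp, fun c hc _ => by simpa [Prefix] using hc⟩
  | insert _ _ ih =>
    rename_i a s _ _
    obtain ⟨d, hd, h1, h2⟩ := ih
    obtain ⟨m, ha, hm, hmin⟩ := 𝒢.prefix_lattice.2.2.2.2 a d
    refine ⟨m, ?_, ?_, ?_⟩
    · have := 𝒢.pos.mul_mem hd hm
      simpa using this
    · intro x hx
      rcases hx with rfl | hx
      · exact ha
      · exact 𝒢.prefix_lattice.2.1 _ _ _ (h1 x hx) hm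
    · intro c hc hxc
      exact hmin c (hxc a (Set.mem_insert _ _))
        (h2 c hc (fun x hx => hxc x (Set.mem_insert_of_mem _ hx)))

theorem isJoin_unique {X : Set G} {d d' : G} (h : 𝒢.IsJoin X d) (h' : 𝒢.IsJoin X d') : d = d' :=
  𝒢.prefix_lattice.2.2.1 d d' (h.2.2 d' h'.1 h'.2.1) (h'.2.2 d h.1 h.2.1)

end GarsideStructure

/-!
The heart of the argument is a subgroup `I` containing the parabolic closures of its elements, for
instance an intersection of two parabolic subgroups, and an element `α ∈ I` at which `φ` is maximal.

*Parabolic closures.* Conjugating an element `x = a⁻¹ b` (reduced fraction) repeatedly by its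
denominator yields elements of bounded size, hence eventually a recurrent one. If `c` is positive
and conjugates a recurrent `x` to a recurrent `y`, it can be transported along both swap orbits,
and the transported elements stay positive and bounded, so that some iterated transport is `c`
again (`exists_transport_eq`). Then `c` conjugates the product of the denominators and the
numerators met along the orbit of `x` to the corresponding product for `y`. Both products are
positive and have the supports of `x` and `y`, so that support-preservation applies
(`IsSupportPreserving.conjSubgroup_eq`). It follows that a recurrent `x` has the parabolic closure
`G_U`, where `U` is its support.

*Reduction.* After a conjugation `α` is recurrent, say with `δ = Δ_U` for its support `U`. Take `w
∈ I`. For a central power `Δ ^ e` consider the elements `β = w δ ^ (e n)` of `I`. It is enough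
that the parabolic closures of two of them coincide: this closure contains a power of `δ`, hence
contains `G_δ`, and it is equal to `G_δ` because `φ` is maximal at `α`
(`conjSubgroup_eq_of_length_le`); so it contains `w`.

*Finiteness.* Let `y` be a recurrent iterated swap of `β` and let `V` be its support. By
maximality `|Δ_V| ≤ |δ|`. The length of `y` is `e n |δ|` up to a constant, while its numerator is
a product of `e n` divisors of `Δ_V` up to a constant number. So for large `n` one of these
divisors is `Δ_V`, which makes the denominator of `y` trivial: `y` is positive and divisible by
`Δ_V`. Write `β = g⁻¹ (y g)`, where the positive element `g` is the product of the denominators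
met. This fraction is reduced (`leftDen_eq_swapConj`). Indeed, if an atom `s` is a prefix of `g`
and of `y g`, then some nontrivial prefix of `g` conjugates `y` to a positive element, contrary to
the minimality of `g`: it is `s` if `s` divides `Δ_V`, and otherwise the element `r` with `Δ_{V ∪
{s}} = Δ_V r`, which conjugates `G_V` to a standard parabolic subgroup; here squarefreeness shows
that `r` is a prefix of `g` (`exists_prefix_conj_mem`). Hence `g` is the denominator of `β`, which
divides a power of `Δ` independent of `n`, and there are finitely many pairs `(g, V)` and
parabolic closures `G_V ^ g`.
-/

namespace GarsideStructure

variable {G : Type*} [Group G] {𝒢 : GarsideStructure G}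

/-! ### Positive elements, divisors and balanced elements -/

theorem mem_divisors (𝒢 : GarsideStructure G) {δ a : G} :
    a ∈ 𝒢.divisors δ ↔ a ∈ 𝒢.pos ∧ a⁻¹ * δ ∈ 𝒢.pos := by
  simp [divisors, Prefix]

theorem Prefix.trans {a b c : G} (h : 𝒢.Prefix a b) (h' : 𝒢.Prefix b c) : 𝒢.Prefix a c :=
  𝒢.prefix_lattice.2.1 _ _ _ h h'

theorem Prefix.antisymm {a b : G} (h : 𝒢.Prefix a b) (h' : 𝒢.Prefix b a) : a = b :=
  𝒢.prefix_lattice.2.2.1 _ _ h h'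

theorem prefix_mul_right {a b : G} (hb : b ∈ 𝒢.pos) : 𝒢.Prefix a (a * b) := by
  simpa [Prefix] using hb

theorem Balanced.mul_inv_mem {δ a : G} (hδ : 𝒢.Balanced δ) (ha : a ∈ 𝒢.divisors δ) :
    δ * a⁻¹ ∈ 𝒢.pos := by
  rw [hδ.2] at ha
  exact ha.2

theorem Balanced.mem_divisors_of_suffix {δ a : G} (hδ : 𝒢.Balanced δ) (ha : a ∈ 𝒢.pos)
    (h : δ * a⁻¹ ∈ 𝒢.pos) : a ∈ 𝒢.divisors δ := by
  rw [hδ.2]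
  exact ⟨by simpa [Suffix] using ha, h⟩

theorem balanced_Delta (𝒢 : GarsideStructure G) : 𝒢.Balanced 𝒢.Delta := by
  refine ⟨𝒢.Delta_pos, ?_⟩
  have := 𝒢.Delta_balanced
  simpa [divisors, Prefix, Suffix] using this

theorem self_mem_divisors {δ : G} (hδ : δ ∈ 𝒢.pos) : δ ∈ 𝒢.divisors δ :=
  𝒢.mem_divisors.2 ⟨hδ, by simp [𝒢.pos.one_mem]⟩

theorem Balanced.inv_mul_mem_divisors {δ s : G} (hδ : 𝒢.Balanced δ) (hs : s ∈ 𝒢.divisors δ) :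
    s⁻¹ * δ ∈ 𝒢.divisors δ :=
  hδ.mem_divisors_of_suffix (𝒢.mem_divisors.1 hs).2 (by simpa using (𝒢.mem_divisors.1 hs).1)

theorem Balanced.mul_inv_mem_divisors {δ s : G} (hδ : 𝒢.Balanced δ) (hs : s ∈ 𝒢.divisors δ) :
    δ * s⁻¹ ∈ 𝒢.divisors δ :=
  𝒢.mem_divisors.2 ⟨hδ.mul_inv_mem hs, by simpa using (𝒢.mem_divisors.1 hs).1⟩

theorem Balanced.conj_mem_divisors {δ s : G} (hδ : 𝒢.Balanced δ) (hs : s ∈ 𝒢.divisors δ) :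
    δ⁻¹ * s * δ ∈ 𝒢.divisors δ := by
  simpa using hδ.inv_mul_mem_divisors (hδ.inv_mul_mem_divisors hs)

theorem Balanced.conj_inv_mem_divisors {δ s : G} (hδ : 𝒢.Balanced δ) (hs : s ∈ 𝒢.divisors δ) :
    δ * s * δ⁻¹ ∈ 𝒢.divisors δ := by
  simpa [mul_assoc] using hδ.mul_inv_mem_divisors (hδ.mul_inv_mem_divisors hs)

theorem Balanced.of_mul_mem_divisors {δ x y : G} (hδ : 𝒢.Balanced δ) (hx : x ∈ 𝒢.pos)
    (hy : y ∈ 𝒢.pos) (h : x * y ∈ 𝒢.divisors δ) : x ∈ 𝒢.divisors δ ∧ y ∈ 𝒢.divisors δ := by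
  refine ⟨𝒢.mem_divisors.2 ⟨hx, ?_⟩, hδ.mem_divisors_of_suffix hy ?_⟩
  · simpa [mul_assoc] using 𝒢.pos.mul_mem hy (𝒢.mem_divisors.1 h).2
  · simpa [mul_assoc] using 𝒢.pos.mul_mem (hδ.mul_inv_mem h) hx

variable (𝒢) in
/-- The monoid generated by the divisors of `δ`. When `δ` is standard, it consists of the positive
elements of the parabolic subgroup `G_δ`. -/
def divMonoid (δ : G) : Submonoid G := Submonoid.closure (𝒢.divisors δ)

theorem mem_divMonoid_of_mem {δ s : G} (hs : s ∈ 𝒢.divisors δ) : s ∈ 𝒢.divMonoid δ :=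
  Submonoid.subset_closure hs

theorem divMonoid_le_pos (δ : G) : 𝒢.divMonoid δ ≤ 𝒢.pos :=
  Submonoid.closure_le.2 fun _ hs => (𝒢.mem_divisors.1 hs).1

theorem divMonoid_Delta (𝒢 : GarsideStructure G) : 𝒢.divMonoid 𝒢.Delta = 𝒢.pos := by
  have := 𝒢.simples_generate
  rw [divMonoid]
  convert this using 2
  ext a
  exact 𝒢.mem_divisors

theorem Balanced.conj_mem {δ m : G} (hδ : 𝒢.Balanced δ) (hm : m ∈ 𝒢.divMonoid δ) :
    δ⁻¹ * m * δ ∈ 𝒢.divMonoid δ := by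
  induction hm using Submonoid.closure_induction with
  | mem s hs => exact mem_divMonoid_of_mem (hδ.conj_mem_divisors hs)
  | one => simp
  | mul x y _ _ hx hy => simpa [mul_assoc] using mul_mem hx hy

theorem Balanced.conj_inv_mem {δ m : G} (hδ : 𝒢.Balanced δ) (hm : m ∈ 𝒢.divMonoid δ) :
    δ * m * δ⁻¹ ∈ 𝒢.divMonoid δ := by
  induction hm using Submonoid.closure_induction with
  | mem s hs => exact mem_divMonoid_of_mem (hδ.conj_inv_mem_divisors hs)
  | one => simp
  | mul x y _ _ hx hy => simpa [mul_assoc] using mul_mem hx hy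

theorem Balanced.pow_conj_inv_mem {δ m : G} (hδ : 𝒢.Balanced δ) (k : ℕ)
    (hm : m ∈ 𝒢.divMonoid δ) : δ ^ k * m * (δ ^ k)⁻¹ ∈ 𝒢.divMonoid δ := by
  induction k with
  | zero => simpa using hm
  | succ k ih => simpa [pow_succ', mul_assoc] using hδ.conj_inv_mem ih

theorem Balanced.exists_pow_mul_inv_mem {δ m : G} (hδ : 𝒢.Balanced δ)
    (hm : m ∈ 𝒢.divMonoid δ) : ∃ k : ℕ, δ ^ k * m⁻¹ ∈ 𝒢.divMonoid δ := by
  induction hm using Submonoid.closure_induction_left with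
  | one => exact ⟨0, by simp⟩
  | mul_left s hs m _ ih =>
    obtain ⟨k, hk⟩ := ih
    refine ⟨k + 1, ?_⟩
    have := mul_mem (hδ.conj_inv_mem hk) (mem_divMonoid_of_mem (hδ.mul_inv_mem_divisors hs))
    simpa [pow_succ', mul_assoc] using this

/-- Every element of the group generated by `Div δ` is a fraction whose denominator is a power
of `δ`. -/
theorem Balanced.exists_pow_mul_mem {δ x : G} (hδ : 𝒢.Balanced δ)
    (hx : x ∈ Subgroup.closure (𝒢.divisors δ)) : ∃ n : ℕ, δ ^ n * x ∈ 𝒢.divMonoid δ := by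
  induction hx using Subgroup.closure_induction with
  | mem s hs => exact ⟨0, by simpa using mem_divMonoid_of_mem hs⟩
  | one => exact ⟨0, by simp⟩
  | mul x y _ _ hx hy =>
    obtain ⟨n, hn⟩ := hx
    obtain ⟨k, hk⟩ := hy
    refine ⟨k + n, ?_⟩
    have := mul_mem (hδ.pow_conj_inv_mem k hn) hk
    simpa [pow_add, mul_assoc] using this
  | inv x _ hx =>
    obtain ⟨n, hn⟩ := hx
    obtain ⟨k, hk⟩ := hδ.exists_pow_mul_inv_mem hn
    refine ⟨k, ?_⟩
    have := mul_mem hk (pow_mem (mem_divMonoid_of_mem (self_mem_divisors hδ.1)) n)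
    simpa [mul_assoc] using this

/-! ### Standard parabolic subgroups -/

theorem DefinesStandard.divisors_subset_simples {δ : G} (hδ : 𝒢.DefinesStandard δ) :
    𝒢.divisors δ ⊆ 𝒢.simples := by
  rw [hδ.2.2]; exact Set.inter_subset_left

theorem DefinesStandard.divisors_subset_parabolicOf {δ : G} (hδ : 𝒢.DefinesStandard δ) :
    𝒢.divisors δ ⊆ (𝒢.parabolicOf δ : Set G) := by
  rw [hδ.2.2]; exact fun x hx => hx.2.1

theorem DefinesStandard.divMonoid_subset_parabolicOf {δ x : G} (hδ : 𝒢.DefinesStandard δ)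
    (hx : x ∈ 𝒢.divMonoid δ) : x ∈ 𝒢.parabolicOf δ := by
  have : 𝒢.divMonoid δ ≤ (𝒢.parabolicOf δ).toSubmonoid :=
    Submonoid.closure_le.2 hδ.divisors_subset_parabolicOf
  exact this hx

theorem simples_of_mul_mem {x y : G} (hx : x ∈ 𝒢.pos) (hy : y ∈ 𝒢.pos)
    (h : x * y ∈ 𝒢.simples) : x ∈ 𝒢.simples ∧ y ∈ 𝒢.simples :=
  𝒢.balanced_Delta.of_mul_mem_divisors hx hy h

/-- The simple prefixes of an element of the monoid of a standard parabolic subgroup `G_δ` divide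
`δ`: the join of such a prefix with a divisor of `δ` is simple and lies in `G_δ`. -/
theorem DefinesStandard.mem_divisors_of_prefix {δ m : G} (hδ : 𝒢.DefinesStandard δ)
    (hm : m ∈ 𝒢.divMonoid δ) : ∀ x ∈ 𝒢.simples, 𝒢.Prefix x m → x ∈ 𝒢.divisors δ := by
  induction hm using Submonoid.closure_induction_left with
  | one =>
    intro x hx h
    have hx' := (𝒢.mem_divisors.1 hx).1
    rw [𝒢.eq_one_of_mem_of_inv_mem hx' (by simpa [Prefix] using h)]
    exact 𝒢.mem_divisors.2 ⟨one_mem _, by simpa using hδ.1.1⟩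
  | mul_left s hs m hm ih =>
    intro x hx h
    have hx' := (𝒢.mem_divisors.1 hx).1
    have hsS := hδ.divisors_subset_simples hs
    have hsp := (𝒢.mem_divisors.1 hs).1
    obtain ⟨j, hxj, hsj, hj⟩ := 𝒢.prefix_lattice.2.2.2.2 x s
    have hjm : 𝒢.Prefix j (s * m) := hj _ h (prefix_mul_right (divMonoid_le_pos _ hm))
    have hjS : 𝒢.Prefix j 𝒢.Delta := hj _ hx.2 hsS.2
    have hjp : j ∈ 𝒢.pos := by simpa using 𝒢.pos.mul_mem hsp hsj
    have hj' : j ∈ 𝒢.simples := 𝒢.mem_divisors.2 ⟨hjp, hjS⟩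
    have hx'' : s⁻¹ * j ∈ 𝒢.simples :=
      (simples_of_mul_mem hsp hsj (by simpa using hj')).2
    have h1 := ih _ hx'' (by simpa [Prefix, mul_assoc] using hjm)
    have hjB : j ∈ 𝒢.parabolicOf δ := by
      simpa using mul_mem (hδ.divisors_subset_parabolicOf hs)
        (hδ.divisors_subset_parabolicOf h1)
    have hjδ : j ∈ 𝒢.divisors δ := by
      rw [hδ.2.2]; exact ⟨hj', hjB, hjp⟩
    exact 𝒢.mem_divisors.2 ⟨hx', Prefix.trans hxj (𝒢.mem_divisors.1 hjδ).2⟩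

theorem DefinesStandard.mem_divisors_of_mem {δ x : G} (hδ : 𝒢.DefinesStandard δ)
    (hx : x ∈ 𝒢.divMonoid δ) (hs : x ∈ 𝒢.simples) : x ∈ 𝒢.divisors δ :=
  hδ.mem_divisors_of_prefix hx x hs (by simp [Prefix, one_mem])

theorem DefinesStandard.inv_mul_mem {δ m : G} (hδ : 𝒢.DefinesStandard δ)
    (hm : m ∈ 𝒢.divMonoid δ) :
    ∀ c ∈ 𝒢.divisors δ, 𝒢.Prefix c m → c⁻¹ * m ∈ 𝒢.divMonoid δ := by
  induction hm using Submonoid.closure_induction_left with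
  | one =>
    intro c hc h
    rw [𝒢.eq_one_of_mem_of_inv_mem (𝒢.mem_divisors.1 hc).1 (by simpa [Prefix] using h)]
    simp
  | mul_left s hs m hm ih =>
    intro c hc h
    have hsp := (𝒢.mem_divisors.1 hs).1
    have hcp := (𝒢.mem_divisors.1 hc).1
    obtain ⟨j, hcj, hsj, hj⟩ := 𝒢.prefix_lattice.2.2.2.2 c s
    have hjm : 𝒢.Prefix j (s * m) := hj _ h (prefix_mul_right (divMonoid_le_pos _ hm))
    have hjp : j ∈ 𝒢.pos := by simpa using 𝒢.pos.mul_mem hsp hsj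
    have hjδ : j ∈ 𝒢.divisors δ :=
      𝒢.mem_divisors.2 ⟨hjp, hj _ (𝒢.mem_divisors.1 hc).2 (𝒢.mem_divisors.1 hs).2⟩
    have h1 : s⁻¹ * j ∈ 𝒢.divisors δ :=
      (hδ.1.of_mul_mem_divisors hsp hsj (by simpa using hjδ)).2
    have h2 : c⁻¹ * j ∈ 𝒢.divisors δ :=
      (hδ.1.of_mul_mem_divisors hcp hcj (by simpa using hjδ)).2
    have h3 := ih _ h1 (by simpa [Prefix, mul_assoc] using hjm)
    simpa [mul_assoc] using mul_mem (mem_divMonoid_of_mem h2) h3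

/-- The monoid of a standard parabolic subgroup is closed under taking factors. -/
theorem DefinesStandard.of_mul_mem {δ x y : G} (hδ : 𝒢.DefinesStandard δ) (hx : x ∈ 𝒢.pos)
    (hy : y ∈ 𝒢.pos) (h : x * y ∈ 𝒢.divMonoid δ) :
    x ∈ 𝒢.divMonoid δ ∧ y ∈ 𝒢.divMonoid δ := by
  rw [← 𝒢.divMonoid_Delta] at hx
  induction hx using Submonoid.closure_induction_left with
  | one => exact ⟨one_mem _, by simpa using h⟩
  | mul_left s hs x hx ih =>
    rw [mul_assoc] at h
    have hxy : x * y ∈ 𝒢.pos := mul_mem (divMonoid_le_pos _ hx) hy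
    have hsδ := hδ.mem_divisors_of_prefix h s hs (prefix_mul_right hxy)
    have := ih (by simpa using hδ.inv_mul_mem h s hsδ (prefix_mul_right hxy))
    exact ⟨mul_mem (mem_divMonoid_of_mem hsδ) this.1, this.2⟩

/-- The letters of any word in the atoms for an element of `G_δ` divide `δ`. -/
theorem DefinesStandard.mem_divisors_of_mem_list {δ : G} (hδ : 𝒢.DefinesStandard δ) {l : List G}
    (hl : ∀ b ∈ l, b ∈ 𝒢.atoms) (hp : l.prod ∈ 𝒢.divMonoid δ) : ∀ b ∈ l, b ∈ 𝒢.divisors δ := by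
  induction l with
  | nil => simp
  | cons c l ih =>
    intro b hb
    rw [List.prod_cons] at hp
    have hc := hl c (by simp)
    have hlp : l.prod ∈ 𝒢.pos :=
      𝒢.pos.list_prod_mem fun d hd => (𝒢.mem_divisors.1 (hl d (by simp [hd])).1).1
    have := hδ.of_mul_mem (𝒢.mem_divisors.1 hc.1).1 hlp hp
    rcases List.mem_cons.1 hb with rfl | hb
    · exact hδ.mem_divisors_of_mem this.1 hc.1
    · exact ih (fun d hd => hl d (by simp [hd])) this.2 b hb

theorem parabolicOf_le_closure (δ : G) :
    𝒢.parabolicOf δ ≤ Subgroup.closure (𝒢.divisors δ) :=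
  Subgroup.closure_mono Set.inter_subset_left

theorem DefinesStandard.mem_divMonoid {δ x : G} (hδ : 𝒢.DefinesStandard δ)
    (hx : x ∈ 𝒢.parabolicOf δ) (hp : x ∈ 𝒢.pos) : x ∈ 𝒢.divMonoid δ := by
  obtain ⟨n, hn⟩ := hδ.1.exists_pow_mul_mem (parabolicOf_le_closure δ hx)
  exact (hδ.of_mul_mem (pow_mem hδ.1.1 n) hp hn).2

theorem DefinesStandard.self_mem {δ : G} (hδ : 𝒢.DefinesStandard δ) : δ ∈ 𝒢.divMonoid δ :=
  mem_divMonoid_of_mem (self_mem_divisors hδ.1.1)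

theorem DefinesStandard.parabolicOf_le {δ δ' : G} (hδ' : 𝒢.DefinesStandard δ')
    (h : δ ∈ 𝒢.divisors δ') : 𝒢.parabolicOf δ ≤ 𝒢.parabolicOf δ' := by
  refine (Subgroup.closure_le _).2 fun a ha => hδ'.divisors_subset_parabolicOf ?_
  have ha' := 𝒢.mem_divisors.1 ha.1
  exact 𝒢.mem_divisors.2 ⟨ha'.1, Prefix.trans ha'.2 (𝒢.mem_divisors.1 h).2⟩

/-! ### Reduced fractions -/

theorem leftDen_mem (x : G) : 𝒢.leftDen x ∈ 𝒢.pos := (𝒢.isReducedFraction_fraction x).1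

theorem leftNum_mem (x : G) : 𝒢.leftNum x ∈ 𝒢.pos := (𝒢.isReducedFraction_fraction x).2.1

theorem leftDen_mul (x : G) : 𝒢.leftDen x * x = 𝒢.leftNum x := by
  have : x = (𝒢.leftDen x)⁻¹ * 𝒢.leftNum x := (𝒢.isReducedFraction_fraction x).2.2.1
  exact (eq_inv_mul_iff_mul_eq.1 this)

/-- The left-denominator is the least left multiplier making an element positive. -/
theorem mul_leftDen_inv_mem {x c : G} (hc : c ∈ 𝒢.pos) (hcx : c * x ∈ 𝒢.pos) :
    c * (𝒢.leftDen x)⁻¹ ∈ 𝒢.pos := by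
  have := (𝒢.isReducedFraction_fraction x).2.2.2 (𝒢.leftDen x * c⁻¹)
    (by simpa [Prefix, leftDen] using hc)
    (by
      change (𝒢.leftDen x * c⁻¹)⁻¹ * 𝒢.leftNum x ∈ _
      simpa [mul_assoc, ← leftDen_mul] using hcx)
  simpa [Prefix] using this

theorem fraction_eq {x a b : G} (ha : a ∈ 𝒢.pos) (hb : b ∈ 𝒢.pos) (hx : x = a⁻¹ * b)
    (h : ∀ c ∈ 𝒢.pos, 𝒢.Prefix c a → 𝒢.Prefix c b → c = 1) : 𝒢.fraction x = (a, b) := by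
  refine 𝒢.fraction_unique (𝒢.isReducedFraction_fraction x) ⟨ha, hb, hx, fun c hca hcb => ?_⟩
  obtain ⟨j, h1, hcj, hj⟩ := 𝒢.prefix_lattice.2.2.2.2 1 c
  have := h j (by simpa using h1) (hj _ (by simpa using ha) hca) (hj _ (by simpa using hb) hcb)
  rw [← this]
  exact hcj

theorem eq_one_of_prefix_leftDen_leftNum {x c : G} (hc : c ∈ 𝒢.pos)
    (h : 𝒢.Prefix c (𝒢.leftDen x)) (h' : 𝒢.Prefix c (𝒢.leftNum x)) : c = 1 :=
  𝒢.eq_one_of_mem_of_inv_mem hc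
    (by simpa [Prefix] using (𝒢.isReducedFraction_fraction x).2.2.2 c h h')

theorem fraction_inv (x : G) : 𝒢.fraction x⁻¹ = (𝒢.leftNum x, 𝒢.leftDen x) :=
  fraction_eq (leftNum_mem x) (leftDen_mem x) (by rw [← leftDen_mul]; simp)
    fun _ hc h h' => eq_one_of_prefix_leftDen_leftNum hc h' h

theorem leftDen_inv (x : G) : 𝒢.leftDen x⁻¹ = 𝒢.leftNum x := by rw [leftDen, fraction_inv]

theorem leftNum_inv (x : G) : 𝒢.leftNum x⁻¹ = 𝒢.leftDen x := by rw [leftNum, fraction_inv]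

theorem leftDen_of_pos {x : G} (hx : x ∈ 𝒢.pos) : 𝒢.leftDen x = 1 := by
  have := mul_leftDen_inv_mem (x := x) 𝒢.pos.one_mem (by simpa using hx)
  exact 𝒢.eq_one_of_mem_of_inv_mem (leftDen_mem x) (by simpa using this)

/-- Denominators of elements of a standard parabolic subgroup lie in it. -/
theorem DefinesStandard.leftDen_mem {δ x : G} (hδ : 𝒢.DefinesStandard δ)
    (hx : x ∈ 𝒢.parabolicOf δ) : 𝒢.leftDen x ∈ 𝒢.divMonoid δ := by
  obtain ⟨n, hn⟩ := hδ.1.exists_pow_mul_mem (parabolicOf_le_closure δ hx)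
  have := mul_leftDen_inv_mem (pow_mem hδ.1.1 n) (divMonoid_le_pos _ hn)
  exact (hδ.of_mul_mem this (GarsideStructure.leftDen_mem x)
    (by simpa using pow_mem hδ.self_mem n)).2

theorem DefinesStandard.leftNum_mem {δ x : G} (hδ : 𝒢.DefinesStandard δ)
    (hx : x ∈ 𝒢.parabolicOf δ) : 𝒢.leftNum x ∈ 𝒢.divMonoid δ := by
  rw [← leftDen_inv]
  exact hδ.leftDen_mem (inv_mem hx)

theorem DefinesStandard.mem_parabolicOf_of_leftDen_leftNum {δ x : G} (hδ : 𝒢.DefinesStandard δ)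
    (ha : 𝒢.leftDen x ∈ 𝒢.divMonoid δ) (hb : 𝒢.leftNum x ∈ 𝒢.divMonoid δ) :
    x ∈ 𝒢.parabolicOf δ := by
  have : x = (𝒢.leftDen x)⁻¹ * 𝒢.leftNum x := by simp [← leftDen_mul]
  rw [this]
  exact mul_mem (inv_mem (hδ.divMonoid_subset_parabolicOf ha))
    (hδ.divMonoid_subset_parabolicOf hb)

/-! ### Supports -/

variable (𝒢) in
/-- The letters of the words chosen for the denominator and the numerator of `x`. -/
def supportLetters (x : G) : Set G :=
  {a | a ∈ 𝒢.atomWord (𝒢.leftDen x) ∨ a ∈ 𝒢.atomWord (𝒢.leftNum x)}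

theorem supportLetters_subset (x : G) : 𝒢.supportLetters x ⊆ 𝒢.atoms := by
  rintro a (h | h)
  · exact (𝒢.isAtomWord_atomWord (leftDen_mem x)).1 a h
  · exact (𝒢.isAtomWord_atomWord (leftNum_mem x)).1 a h

theorem deltaOf_atomClosure {X : Set G} (hX : X ⊆ 𝒢.atoms) :
    𝒢.deltaOf (𝒢.atomClosure X) = 𝒢.deltaOf X := by
  have h := 𝒢.isJoin_deltaOf hX
  refine 𝒢.isJoin_unique (𝒢.isJoin_deltaOf Set.inter_subset_right) ⟨h.1, ?_, fun c hc hXc => ?_⟩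
  · exact fun x hx => hx.1.2
  · exact h.2.2 c hc fun x hx => hXc x ⟨⟨(hX hx).1.1, h.2.1 x hx⟩, hX hx⟩

variable (𝒢) in
/-- `Δ_U`, where `U` is the support of `x`. -/
noncomputable def suppDelta (x : G) : G := 𝒢.deltaOf (𝒢.support x)

theorem suppDelta_eq (x : G) : 𝒢.suppDelta x = 𝒢.deltaOf (𝒢.supportLetters x) :=
  deltaOf_atomClosure (supportLetters_subset x)

theorem support_subset (x : G) : 𝒢.support x ⊆ 𝒢.atoms := Set.inter_subset_right

theorem IsLCM.suppDelta (h : 𝒢.IsLCM) (x : G) : 𝒢.DefinesStandard (𝒢.suppDelta x) :=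
  h.standard _ (support_subset x)

/-- A standard parabolic subgroup `G_δ` containing `x` contains the support of `x`. -/
theorem DefinesStandard.suppDelta_mem_divisors {δ x : G} (hδ : 𝒢.DefinesStandard δ)
    (hx : x ∈ 𝒢.parabolicOf δ) : 𝒢.suppDelta x ∈ 𝒢.divisors δ := by
  rw [suppDelta_eq]
  have hj := 𝒢.isJoin_deltaOf (supportLetters_subset (𝒢 := 𝒢) x)
  refine 𝒢.mem_divisors.2 ⟨hj.1, hj.2.2 δ hδ.1.1 fun a ha => ?_⟩
  rcases ha with ha | ha
  · have := 𝒢.isAtomWord_atomWord (GarsideStructure.leftDen_mem (𝒢 := 𝒢) x)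
    exact (hδ.mem_divisors_of_mem_list this.1 (by rw [this.2]; exact hδ.leftDen_mem hx) a ha).2
  · have := 𝒢.isAtomWord_atomWord (GarsideStructure.leftNum_mem (𝒢 := 𝒢) x)
    exact (hδ.mem_divisors_of_mem_list this.1 (by rw [this.2]; exact hδ.leftNum_mem hx) a ha).2

theorem IsLCM.mem_parabolicOf_suppDelta (h : 𝒢.IsLCM) (x : G) :
    x ∈ 𝒢.parabolicOf (𝒢.suppDelta x) := by
  have key : ∀ y ∈ 𝒢.pos, (∀ a ∈ 𝒢.atomWord y, a ∈ 𝒢.supportLetters x) →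
      y ∈ 𝒢.divMonoid (𝒢.suppDelta x) := by
    intro y hy hl
    have hw := 𝒢.isAtomWord_atomWord hy
    rw [← hw.2]
    refine Submonoid.list_prod_mem _ fun a ha => mem_divMonoid_of_mem ?_
    rw [suppDelta_eq]
    exact ⟨(hw.1 a ha).1.1, (𝒢.isJoin_deltaOf (supportLetters_subset x)).2.1 a (hl a ha)⟩
  exact (h.suppDelta x).mem_parabolicOf_of_leftDen_leftNum
    (key _ (leftDen_mem x) fun a ha => Or.inl ha) (key _ (leftNum_mem x) fun a ha => Or.inr ha)

/-- Elements contained in the same standard parabolic subgroups have the same `Δ_U`. -/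
theorem IsLCM.suppDelta_congr (h : 𝒢.IsLCM) {x y : G}
    (hxy : ∀ δ, 𝒢.DefinesStandard δ → (x ∈ 𝒢.parabolicOf δ ↔ y ∈ 𝒢.parabolicOf δ)) :
    𝒢.suppDelta x = 𝒢.suppDelta y :=
  Prefix.antisymm
    ((h.suppDelta y).suppDelta_mem_divisors
      ((hxy _ (h.suppDelta y)).2 (h.mem_parabolicOf_suppDelta y))).2
    ((h.suppDelta x).suppDelta_mem_divisors
      ((hxy _ (h.suppDelta x)).1 (h.mem_parabolicOf_suppDelta x))).2

theorem IsLCM.suppDelta_pow (h : 𝒢.IsLCM) {δ : G} (hδ : 𝒢.DefinesStandard δ) {k : ℕ}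
    (hk : k ≠ 0) : 𝒢.suppDelta (δ ^ k) = δ := by
  have hpos := (h.suppDelta (δ ^ k)).mem_divMonoid (h.mem_parabolicOf_suppDelta (δ ^ k))
    (pow_mem hδ.1.1 k)
  obtain ⟨k, rfl⟩ := Nat.exists_eq_succ_of_ne_zero hk
  have := ((h.suppDelta (δ ^ k.succ)).of_mul_mem hδ.1.1 (pow_mem hδ.1.1 k)
    (by rw [← pow_succ']; exact hpos)).1
  exact Prefix.antisymm
    (hδ.suppDelta_mem_divisors
      (hδ.divMonoid_subset_parabolicOf (pow_mem hδ.self_mem _))).2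
    ((h.suppDelta _).mem_divisors_of_mem this (hδ.2.1)).2

/-! ### A central power of the Garside element -/

theorem exists_central_pow (𝒢 : GarsideStructure G) :
    ∃ e : ℕ, 0 < e ∧ ∀ g : G, Commute (𝒢.Delta ^ e) g := by
  have hb := 𝒢.balanced_Delta
  have hfin : Finite 𝒢.simples := by
    have := 𝒢.simples_finite
    refine (this.subset fun a ha => 𝒢.mem_divisors.1 ha).to_subtype
  let π : Equiv.Perm 𝒢.simples :=
    { toFun := fun s => ⟨𝒢.Delta * s * 𝒢.Delta⁻¹, hb.conj_inv_mem_divisors s.2⟩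
      invFun := fun s => ⟨𝒢.Delta⁻¹ * s * 𝒢.Delta, hb.conj_mem_divisors s.2⟩
      left_inv := fun s => by ext; simp [mul_assoc]
      right_inv := fun s => by ext; simp [mul_assoc] }
  have hπ : ∀ (n : ℕ) (s : 𝒢.simples),
      ((π ^ n) s : G) = 𝒢.Delta ^ n * s * (𝒢.Delta ^ n)⁻¹ := by
    intro n s
    induction n with
    | zero => simp
    | succ n ih =>
      rw [pow_succ', Equiv.Perm.mul_apply]
      change 𝒢.Delta * ((π ^ n) s : G) * 𝒢.Delta⁻¹ = _
      rw [ih]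
      simp [pow_succ', mul_assoc]
  refine ⟨orderOf π, orderOf_pos π, ?_⟩
  have h1 : (𝒢.pos : Set G) ⊆ Subgroup.centralizer {𝒢.Delta ^ orderOf π} := by
    rw [← 𝒢.divMonoid_Delta]
    refine (Submonoid.closure_le (S := (Subgroup.centralizer {𝒢.Delta ^ orderOf π}).toSubmonoid)).2
      fun s hs => ?_
    have := hπ (orderOf π) ⟨s, hs⟩
    rw [pow_orderOf_eq_one] at this
    refine Subgroup.mem_centralizer_singleton_iff.2 ?_
    exact eq_mul_inv_iff_mul_eq.1 this
  intro g
  have hg : g ∈ Subgroup.closure (𝒢.pos : Set G) := by rw [𝒢.pos_generate]; trivial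
  have := (Subgroup.closure_le _).2 h1 hg
  exact (Subgroup.mem_centralizer_singleton_iff.1 this).symm

variable (𝒢) in
/-- An exponent `e > 0` for which `Δ ^ e` is central. -/
noncomputable def centralExp : ℕ := 𝒢.exists_central_pow.choose

variable (𝒢) in
/-- A central power of the Garside element. -/
noncomputable def central : G := 𝒢.Delta ^ 𝒢.centralExp

theorem centralExp_pos : 0 < 𝒢.centralExp := 𝒢.exists_central_pow.choose_spec.1

theorem central_pow_comm (n : ℕ) (g : G) : g * 𝒢.central ^ n = 𝒢.central ^ n * g :=
  ((𝒢.exists_central_pow.choose_spec.2 g).pow_left n).eq.symm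

theorem central_pow_mem (n : ℕ) : 𝒢.central ^ n ∈ 𝒢.pos := pow_mem (pow_mem 𝒢.Delta_pos _) n

theorem exists_central_pow_mul_mem (x : G) : ∃ n : ℕ, 𝒢.central ^ n * x ∈ 𝒢.pos := by
  have htop : x ∈ Subgroup.closure (𝒢.divisors 𝒢.Delta) := by
    have h1 : (𝒢.pos : Set G) ⊆ Subgroup.closure (𝒢.divisors 𝒢.Delta) := by
      rw [← 𝒢.divMonoid_Delta]
      exact (Submonoid.closure_le (S := (Subgroup.closure (𝒢.divisors 𝒢.Delta)).toSubmonoid)).2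
        Subgroup.subset_closure
    have := (Subgroup.closure_le _).2 h1
    rw [𝒢.pos_generate] at this
    exact this trivial
  obtain ⟨n, hn⟩ := 𝒢.balanced_Delta.exists_pow_mul_mem htop
  rw [divMonoid_Delta] at hn
  refine ⟨n, ?_⟩
  obtain ⟨k, hk⟩ : ∃ k, 𝒢.centralExp * n = k + n :=
    ⟨𝒢.centralExp * n - n, (Nat.sub_add_cancel (Nat.le_mul_of_pos_left n centralExp_pos)).symm⟩
  rw [central, ← pow_mul, hk, pow_add, mul_assoc]
  exact mul_mem (pow_mem 𝒢.Delta_pos k) hn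

/-! ### Elements of bounded size -/

/-- A positive prefix of `Δ ^ (k + 1)` is the product of a prefix of `Δ ^ k` and a simple
element. -/
theorem exists_mul_simple {x : G} {k : ℕ} (hx : x ∈ 𝒢.pos)
    (h : 𝒢.Prefix x (𝒢.Delta ^ (k + 1))) :
    ∃ u t, u ∈ 𝒢.pos ∧ 𝒢.Prefix u (𝒢.Delta ^ k) ∧ t ∈ 𝒢.simples ∧ x = u * t := by
  have hb := 𝒢.balanced_Delta
  obtain ⟨u, hux, huD, hu⟩ := 𝒢.prefix_lattice.2.2.2.1 x (𝒢.Delta ^ k)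
  have hup : u ∈ 𝒢.pos := by
    simpa using hu 1 (by simpa using hx) (by simpa using pow_mem 𝒢.Delta_pos k)
  refine ⟨u, u⁻¹ * x, hup, huD, ?_, by simp⟩
  have h1 : (x * 𝒢.Delta⁻¹)⁻¹ * 𝒢.Delta ^ k ∈ 𝒢.pos := by
    have := hb.conj_inv_mem (m := x⁻¹ * 𝒢.Delta ^ (k + 1)) (by rw [divMonoid_Delta]; exact h)
    rw [divMonoid_Delta] at this
    simpa [pow_succ, mul_assoc] using this
  have h2 := hu (x * 𝒢.Delta⁻¹) (by simpa using 𝒢.Delta_pos) h1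
  exact hb.mem_divisors_of_suffix hux (by simpa [mul_assoc] using h2)

theorem finite_prefix_Delta_pow (𝒢 : GarsideStructure G) (k : ℕ) :
    {x | x ∈ 𝒢.pos ∧ 𝒢.Prefix x (𝒢.Delta ^ k)}.Finite := by
  induction k with
  | zero =>
    refine (Set.finite_singleton (1 : G)).subset fun x hx => ?_
    exact 𝒢.eq_one_of_mem_of_inv_mem hx.1 (by simpa [Prefix] using hx.2)
  | succ k ih =>
    have hfin : 𝒢.simples.Finite := 𝒢.simples_finite.subset fun a ha => 𝒢.mem_divisors.1 ha
    refine (Set.Finite.image2 (· * ·) ih hfin).subset ?_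
    rintro x ⟨hx, h⟩
    obtain ⟨u, t, hu, hu', ht, rfl⟩ := exists_mul_simple hx h
    exact ⟨u, ⟨hu, hu'⟩, t, ht, rfl⟩

theorem finite_prefix_central_pow (𝒢 : GarsideStructure G) (k : ℕ) :
    {x | x ∈ 𝒢.pos ∧ x⁻¹ * 𝒢.central ^ k ∈ 𝒢.pos}.Finite := by
  have := 𝒢.finite_prefix_Delta_pow (𝒢.centralExp * k)
  rwa [pow_mul] at this

theorem finite_between (𝒢 : GarsideStructure G) (p q : ℕ) :
    {x | 𝒢.central ^ p * x ∈ 𝒢.pos ∧ x⁻¹ * 𝒢.central ^ q ∈ 𝒢.pos}.Finite := by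
  refine ((𝒢.finite_prefix_central_pow (p + q)).preimage
    (mul_right_injective (𝒢.central ^ p)).injOn).subset fun x hx => ⟨hx.1, ?_⟩
  simpa [pow_add, mul_assoc] using hx.2

/-! ### Swaps and recurrent elements -/

theorem swap_eq (x : G) : 𝒢.swap x = 𝒢.leftDen x * x * (𝒢.leftDen x)⁻¹ := by
  rw [leftDen_mul]; rfl

theorem swap_inv (x : G) : 𝒢.swap x⁻¹ = (𝒢.swap x)⁻¹ := by
  simp [swap, leftDen_inv, leftNum_inv]

theorem swap_of_pos {x : G} (hx : x ∈ 𝒢.pos) : 𝒢.swap x = x := by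
  simp [swap_eq, leftDen_of_pos hx]

theorem isRecurrent_of_pos {x : G} (hx : x ∈ 𝒢.pos) : 𝒢.IsRecurrent x :=
  ⟨1, one_pos, swap_of_pos hx⟩

theorem central_pow_mul_swap_mem {x : G} {p : ℕ} (h : 𝒢.central ^ p * x ∈ 𝒢.pos) :
    𝒢.central ^ p * 𝒢.swap x ∈ 𝒢.pos := by
  have h1 := mul_leftDen_inv_mem (central_pow_mem p) h
  have := mul_mem (leftNum_mem x) h1
  rwa [← mul_assoc, central_pow_comm, mul_assoc] at this

theorem swap_inv_mul_central_pow_mem {x : G} {q : ℕ} (h : x⁻¹ * 𝒢.central ^ q ∈ 𝒢.pos) :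
    (𝒢.swap x)⁻¹ * 𝒢.central ^ q ∈ 𝒢.pos := by
  rw [central_pow_comm] at *
  rw [← swap_inv]
  exact central_pow_mul_swap_mem h

theorem iterate_swap_mem {x : G} {p q : ℕ} (h : 𝒢.central ^ p * x ∈ 𝒢.pos)
    (h' : x⁻¹ * 𝒢.central ^ q ∈ 𝒢.pos) (k : ℕ) :
    𝒢.central ^ p * 𝒢.swap^[k] x ∈ 𝒢.pos ∧ (𝒢.swap^[k] x)⁻¹ * 𝒢.central ^ q ∈ 𝒢.pos := by
  induction k with
  | zero => exact ⟨h, h'⟩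
  | succ k ih =>
    rw [Function.iterate_succ_apply']
    exact ⟨central_pow_mul_swap_mem ih.1, swap_inv_mul_central_pow_mem ih.2⟩

/-- Iterating the swap leads to a recurrent element, since all the iterates are of bounded size. -/
theorem exists_isRecurrent_iterate_swap (x : G) : ∃ k : ℕ, 𝒢.IsRecurrent (𝒢.swap^[k] x) := by
  obtain ⟨p, hp⟩ := exists_central_pow_mul_mem (𝒢 := 𝒢) x
  obtain ⟨q, hq⟩ := exists_central_pow_mul_mem (𝒢 := 𝒢) x⁻¹
  rw [← central_pow_comm] at hq
  obtain ⟨i, j, hij, h⟩ := (𝒢.finite_between p q).exists_lt_map_eq_of_forall_mem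
    (f := fun k : ℕ => 𝒢.swap^[k] x) (iterate_swap_mem hp hq)
  refine ⟨i, j - i, by omega, ?_⟩
  rw [← Function.iterate_add_apply, Nat.sub_add_cancel hij.le]
  exact h.symm

variable (𝒢) in
/-- The product of the first `k` denominators along the swap orbit of `x`, which conjugates `x` to
its `k`-th iterated swap. -/
noncomputable def swapConj (x : G) : ℕ → G
  | 0 => 1
  | k + 1 => 𝒢.leftDen (𝒢.swap^[k] x) * swapConj x k

theorem swapConj_mem (x : G) (k : ℕ) : 𝒢.swapConj x k ∈ 𝒢.pos := by
  induction k with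
  | zero => exact one_mem _
  | succ k ih => exact mul_mem (leftDen_mem _) ih

theorem iterate_swap_eq (x : G) (k : ℕ) :
    𝒢.swap^[k] x = 𝒢.swapConj x k * x * (𝒢.swapConj x k)⁻¹ := by
  induction k with
  | zero => simp [swapConj]
  | succ k ih =>
    rw [Function.iterate_succ_apply', swap_eq, swapConj]
    generalize 𝒢.leftDen (𝒢.swap^[k] x) = d
    rw [ih]
    group

theorem swapConj_add (x : G) (m n : ℕ) :
    𝒢.swapConj x (m + n) = 𝒢.swapConj (𝒢.swap^[n] x) m * 𝒢.swapConj x n := by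
  induction m with
  | zero => simp [swapConj]
  | succ m ih =>
    rw [Nat.succ_add, swapConj, ih, swapConj, Function.iterate_add_apply, mul_assoc]

/-- `swapConj x k * x ^ k` is the product of the first `k` numerators along the swap orbit
of `x`. -/
theorem swapConj_succ_mul_pow (x : G) (k : ℕ) :
    𝒢.swapConj x (k + 1) * x ^ (k + 1) =
      𝒢.leftNum (𝒢.swap^[k] x) * (𝒢.swapConj x k * x ^ k) := by
  rw [← leftDen_mul, swapConj]
  generalize 𝒢.leftDen (𝒢.swap^[k] x) = d
  simp [iterate_swap_eq, pow_succ', mul_assoc]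

theorem swapConj_mul_pow_mem (x : G) (k : ℕ) : 𝒢.swapConj x k * x ^ k ∈ 𝒢.pos := by
  induction k with
  | zero => simp [swapConj, one_mem]
  | succ k ih => rw [swapConj_succ_mul_pow]; exact mul_mem (leftNum_mem _) ih

/-- Iterated swaps reach positive conjugates in the least possible way. -/
theorem mul_swapConj_inv_mem {x c : G} (hc : c ∈ 𝒢.pos) (h : c * x * c⁻¹ ∈ 𝒢.pos) (k : ℕ) :
    c * (𝒢.swapConj x k)⁻¹ ∈ 𝒢.pos := by
  induction k with
  | zero => simpa [swapConj] using hc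
  | succ k ih =>
    have := mul_leftDen_inv_mem (x := 𝒢.swap^[k] x) ih (by
      rw [iterate_swap_eq]
      simpa [mul_assoc] using mul_mem h ih)
    simpa [swapConj, mul_assoc] using this

theorem DefinesStandard.iterate_swap_mem {δ x : G} (hδ : 𝒢.DefinesStandard δ)
    (hx : x ∈ 𝒢.parabolicOf δ) (k : ℕ) :
    𝒢.swapConj x k ∈ 𝒢.parabolicOf δ ∧ 𝒢.swap^[k] x ∈ 𝒢.parabolicOf δ := by
  have h : 𝒢.swapConj x k ∈ 𝒢.parabolicOf δ := by
    induction k with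
    | zero => exact one_mem _
    | succ k ih =>
      refine mul_mem (hδ.divMonoid_subset_parabolicOf (hδ.leftDen_mem ?_)) ih
      rw [iterate_swap_eq]
      exact mul_mem (mul_mem ih hx) (inv_mem ih)
  refine ⟨h, ?_⟩
  rw [iterate_swap_eq]
  exact mul_mem (mul_mem h hx) (inv_mem h)

/-! ### Conjugations between recurrent elements -/

/-- The transport of a positive conjugating element along a swap is positive. -/
theorem transport_mem {x α : G} (hα : α ∈ 𝒢.pos) :
    𝒢.leftDen x * α * (𝒢.leftDen (α⁻¹ * x * α))⁻¹ ∈ 𝒢.pos := by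
  refine mul_leftDen_inv_mem (mul_mem (leftDen_mem x) hα) ?_
  simpa [← leftDen_mul, mul_assoc] using mul_mem (leftNum_mem x) hα

theorem transport_iterate_mem {x α : G} (hα : α ∈ 𝒢.pos) (k : ℕ) :
    𝒢.swapConj x k * α * (𝒢.swapConj (α⁻¹ * x * α) k)⁻¹ ∈ 𝒢.pos := by
  induction k with
  | zero => simpa [swapConj] using hα
  | succ k ih =>
    have h := transport_mem (x := 𝒢.swap^[k] x) ih
    have e : (𝒢.swapConj x k * α * (𝒢.swapConj (α⁻¹ * x * α) k)⁻¹)⁻¹ * 𝒢.swap^[k] x *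
        (𝒢.swapConj x k * α * (𝒢.swapConj (α⁻¹ * x * α) k)⁻¹) =
        𝒢.swap^[k] (α⁻¹ * x * α) := by
      rw [iterate_swap_eq, iterate_swap_eq]; group
    rw [e] at h
    simpa [swapConj, mul_assoc] using h

/-- Some iterated transport along the swap orbits of two recurrent elements fixes a given
conjugating element. -/
theorem exists_transport_eq {x y α : G} (hx : 𝒢.IsRecurrent x) (hy : 𝒢.IsRecurrent y)
    (hα : α ∈ 𝒢.pos) (h : y = α⁻¹ * x * α) :
    ∃ k : ℕ, 0 < k ∧ 𝒢.swapConj x k * α * (𝒢.swapConj y k)⁻¹ = α := by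
  obtain ⟨m, hm, hxm⟩ := hx
  obtain ⟨n, hn, hyn⟩ := hy
  obtain ⟨q, hq⟩ := exists_central_pow_mul_mem (𝒢 := 𝒢) α⁻¹
  have hx' : ∀ i, 𝒢.swap^[m * n * i] x = x := fun i => by
    rw [mul_assoc]; exact (Function.IsPeriodicPt.mul_const (f := 𝒢.swap) hxm _)
  have hy' : ∀ i, 𝒢.swap^[m * n * i] y = y := fun i => by
    rw [mul_comm m n, mul_assoc]; exact (Function.IsPeriodicPt.mul_const (f := 𝒢.swap) hyn _)
  have hbound : ∀ i : ℕ, 𝒢.swapConj x (m * n * i) * α * (𝒢.swapConj y (m * n * i))⁻¹ ∈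
      {c | c ∈ 𝒢.pos ∧ c⁻¹ * 𝒢.central ^ q ∈ 𝒢.pos} := by
    intro i
    refine ⟨by rw [h]; exact transport_iterate_mem hα _, ?_⟩
    have h1 := transport_iterate_mem (x := y) hq (m * n * i)
    have e : (𝒢.central ^ q * α⁻¹)⁻¹ * y * (𝒢.central ^ q * α⁻¹) = x := by
      rw [mul_inv_rev, inv_inv, mul_assoc, mul_assoc, ← mul_assoc y, central_pow_comm, h]
      group
    rw [e] at h1
    rw [← mul_assoc (𝒢.swapConj y _), central_pow_comm, mul_assoc, mul_assoc,
      ← central_pow_comm] at h1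
    simpa [mul_assoc] using h1
  obtain ⟨i, j, hij, he⟩ := (𝒢.finite_prefix_central_pow q).exists_lt_map_eq_of_forall_mem hbound
  refine ⟨m * n * (j - i), Nat.mul_pos (Nat.mul_pos hm hn) (by omega), ?_⟩
  have hj : m * n * j = m * n * i + m * n * (j - i) := by
    rw [← mul_add, Nat.add_sub_cancel' hij.le]
  simp only [hj, swapConj_add, hx', hy'] at he
  have : 𝒢.swapConj x (m * n * i) * α * (𝒢.swapConj y (m * n * i))⁻¹ =
      𝒢.swapConj x (m * n * i) * (𝒢.swapConj x (m * n * (j - i)) * α *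
        (𝒢.swapConj y (m * n * (j - i)))⁻¹) * (𝒢.swapConj y (m * n * i))⁻¹ := by
    rw [he]; group
  exact (mul_left_cancel (mul_right_cancel this)).symm

theorem mem_conjSubgroup {H : Subgroup G} {g x : G} :
    x ∈ conjSubgroup H g ↔ g * x * g⁻¹ ∈ H := by
  rw [conjSubgroup, Subgroup.mem_map]
  constructor
  · rintro ⟨y, hy, rfl⟩
    simpa [mul_assoc] using hy
  · exact fun h => ⟨_, h, by simp [mul_assoc]⟩

theorem conjSubgroup_conjSubgroup (H : Subgroup G) (g h : G) :
    conjSubgroup (conjSubgroup H g) h = conjSubgroup H (g * h) := by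
  ext x
  simp [mem_conjSubgroup, mul_assoc]

theorem conjSubgroup_of_mem {H : Subgroup G} {g : G} (hg : g ∈ H) : conjSubgroup H g = H := by
  ext x
  rw [mem_conjSubgroup]
  rw [Subgroup.mul_mem_cancel_right _ (inv_mem hg), Subgroup.mul_mem_cancel_left _ hg]

theorem conjSubgroup_mono {H K : Subgroup G} (h : H ≤ K) (g : G) :
    conjSubgroup H g ≤ conjSubgroup K g := fun _ hx =>
  mem_conjSubgroup.2 (h (mem_conjSubgroup.1 hx))

theorem conjSubgroup_central_pow (H : Subgroup G) (n : ℕ) :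
    conjSubgroup H (𝒢.central ^ n) = H := by
  ext x
  rw [mem_conjSubgroup, ← central_pow_comm, mul_inv_cancel_right]

/-- A positive element lying in the same standard parabolic subgroups as `x`, built so that
conjugations between recurrent elements carry these elements to each other: the product of the
denominators and the numerators along a piece of the swap orbit of `x`. -/
theorem IsLCM.suppDelta_swapConj (hlcm : 𝒢.IsLCM) (x : G) {k : ℕ} (hk : 0 < k) :
    𝒢.suppDelta (𝒢.swapConj x k * (𝒢.swapConj x k * x ^ k)) = 𝒢.suppDelta x := by
  obtain ⟨k, rfl⟩ := Nat.exists_eq_succ_of_ne_zero hk.ne'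
  refine hlcm.suppDelta_congr fun δ hδ => ⟨fun h => ?_, fun h => ?_⟩
  · have h1 := hδ.mem_divMonoid h (mul_mem (swapConj_mem x _) (swapConj_mul_pow_mem x _))
    obtain ⟨h2, h3⟩ := hδ.of_mul_mem (swapConj_mem x _) (swapConj_mul_pow_mem x _) h1
    have h4 : 𝒢.swapConj x 1 ∈ 𝒢.divMonoid δ := by
      rw [Nat.succ_eq_add_one, swapConj_add] at h2
      exact (hδ.of_mul_mem (swapConj_mem _ _) (swapConj_mem _ _) h2).2
    have h5 : 𝒢.swapConj x 1 * x ^ 1 ∈ 𝒢.divMonoid δ := by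
      have : ∀ n, 𝒢.swapConj x (n + 1) * x ^ (n + 1) ∈ 𝒢.divMonoid δ →
          𝒢.swapConj x 1 * x ^ 1 ∈ 𝒢.divMonoid δ := by
        intro n
        induction n with
        | zero => exact id
        | succ n ih =>
          intro hn
          rw [swapConj_succ_mul_pow] at hn
          exact ih (hδ.of_mul_mem (GarsideStructure.leftNum_mem _) (swapConj_mul_pow_mem x _) hn).2
      exact this k h3
    have := mul_mem (inv_mem (hδ.divMonoid_subset_parabolicOf h4))
      (hδ.divMonoid_subset_parabolicOf h5)
    simpa using this
  · have := (hδ.iterate_swap_mem h (k + 1)).1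
    exact mul_mem this (mul_mem this (pow_mem h _))

/-- Conjugations between recurrent elements carry the parabolic subgroups attached to their
supports to each other. -/
theorem IsSupportPreserving.conjSubgroup_eq (hsupp : 𝒢.IsSupportPreserving) (hlcm : 𝒢.IsLCM)
    {x y α : G} (hx : 𝒢.IsRecurrent x) (hy : 𝒢.IsRecurrent y) (h : α⁻¹ * x * α = y) :
    conjSubgroup (𝒢.parabolicOf (𝒢.suppDelta x)) α = 𝒢.parabolicOf (𝒢.suppDelta y) := by
  obtain ⟨n, hn⟩ := exists_central_pow_mul_mem (𝒢 := 𝒢) α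
  have h' : y = (𝒢.central ^ n * α)⁻¹ * x * (𝒢.central ^ n * α) := by
    rw [← h, mul_inv_rev, mul_assoc, mul_assoc, ← mul_assoc x, central_pow_comm]
    group
  obtain ⟨k, hk, he⟩ := exists_transport_eq hx hy hn h'
  set c := 𝒢.central ^ n * α with hc
  have e1 : c⁻¹ * 𝒢.swapConj x k * c = 𝒢.swapConj y k := by
    rw [mul_assoc, inv_mul_eq_iff_eq_mul]
    exact mul_inv_eq_iff_eq_mul.1 he
  have e2 : c⁻¹ * x ^ k * c = y ^ k := by
    have := conj_pow (i := k) (a := c⁻¹) (b := x)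
    rw [inv_inv] at this
    rw [h', this]
  have := hsupp _ (mul_mem (swapConj_mem x k) (swapConj_mul_pow_mem x k)) _
    (mul_mem (swapConj_mem y k) (swapConj_mul_pow_mem y k)) c (by
      rw [← e2, ← e1]; group)
  change conjSubgroup (𝒢.parabolicOf (𝒢.suppDelta _)) c = 𝒢.parabolicOf (𝒢.suppDelta _) at this
  rw [hlcm.suppDelta_swapConj x hk, hlcm.suppDelta_swapConj y hk, hc,
    ← conjSubgroup_conjSubgroup, conjSubgroup_central_pow] at this
  exact this

/-! ### Parabolic closures -/

theorem IsParabolic.conj {P : Subgroup G} (hP : 𝒢.IsParabolic P) (g : G) :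
    𝒢.IsParabolic (conjSubgroup P g) := by
  obtain ⟨H, h, hH, rfl⟩ := hP
  exact ⟨H, h * g, hH, conjSubgroup_conjSubgroup H h g⟩

theorem isParabolic_parabolicOf {δ : G} (hδ : 𝒢.DefinesStandard δ) :
    𝒢.IsParabolic (𝒢.parabolicOf δ) :=
  ⟨_, 1, ⟨δ, hδ, rfl⟩, (conjSubgroup_of_mem (one_mem _)).symm⟩

/-- If `G_δ ^ g` contains the recurrent element `x`, then iterated swaps inside `G_δ` lead from
`g x g⁻¹` to a recurrent element `y` of `G_δ`, so that the parabolic subgroup attached to the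
support of `x` is conjugate, by an element of `G_δ g`, to the one attached to a divisor of `δ`. -/
theorem DefinesStandard.exists_conj_suppDelta {δ x g : G} (hδ : 𝒢.DefinesStandard δ)
    (hsupp : 𝒢.IsSupportPreserving) (hlcm : 𝒢.IsLCM) (hx : 𝒢.IsRecurrent x)
    (hxg : x ∈ conjSubgroup (𝒢.parabolicOf δ) g) :
    ∃ y h, h ∈ 𝒢.parabolicOf δ ∧ 𝒢.suppDelta y ∈ 𝒢.divisors δ ∧
      conjSubgroup (𝒢.parabolicOf (𝒢.suppDelta y)) (h * g) = 𝒢.parabolicOf (𝒢.suppDelta x) := by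
  have hxg' := mem_conjSubgroup.1 hxg
  obtain ⟨k, hk⟩ := exists_isRecurrent_iterate_swap (𝒢 := 𝒢) (g * x * g⁻¹)
  obtain ⟨h1, h2⟩ := hδ.iterate_swap_mem hxg' k
  refine ⟨_, _, h1, hδ.suppDelta_mem_divisors h2, ?_⟩
  refine hsupp.conjSubgroup_eq hlcm hk hx ?_
  rw [iterate_swap_eq]
  group

/-- The parabolic closure of a recurrent element is the standard parabolic subgroup attached to
its support. -/
theorem IsSupportPreserving.isParabolicClosure (hsupp : 𝒢.IsSupportPreserving) (hlcm : 𝒢.IsLCM)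
    {x : G} (hx : 𝒢.IsRecurrent x) :
    𝒢.IsParabolicClosure x (𝒢.parabolicOf (𝒢.suppDelta x)) := by
  refine ⟨⟨isParabolic_parabolicOf (hlcm.suppDelta x), hlcm.mem_parabolicOf_suppDelta x⟩, ?_⟩
  rintro Q ⟨⟨_, g, ⟨δ, hδ, rfl⟩, rfl⟩, hxQ⟩
  obtain ⟨y, h, hh, hy, e⟩ := hδ.exists_conj_suppDelta hsupp hlcm hx hxQ
  rw [← e, ← conjSubgroup_of_mem hh, conjSubgroup_conjSubgroup]
  exact conjSubgroup_mono (hδ.parabolicOf_le hy) _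

/-! ### Lengths -/

theorem IsHomogeneous.length_eq (hhom : 𝒢.IsHomogeneous) {x : G} {l : List G}
    (h : 𝒢.IsAtomWord x l) (hx : x ∈ 𝒢.pos) : 𝒢.length x = l.length :=
  hhom x _ _ (𝒢.isAtomWord_atomWord hx) h

theorem IsHomogeneous.length_one (hhom : 𝒢.IsHomogeneous) : 𝒢.length (1 : G) = 0 :=
  hhom.length_eq (l := []) ⟨by simp, by simp⟩ (one_mem _)

theorem IsHomogeneous.length_mul (hhom : 𝒢.IsHomogeneous) {x y : G} (hx : x ∈ 𝒢.pos)
    (hy : y ∈ 𝒢.pos) : 𝒢.length (x * y) = 𝒢.length x + 𝒢.length y := by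
  have h1 := 𝒢.isAtomWord_atomWord hx
  have h2 := 𝒢.isAtomWord_atomWord hy
  rw [hhom.length_eq (l := 𝒢.atomWord x ++ 𝒢.atomWord y) ⟨?_, ?_⟩ (mul_mem hx hy),
    List.length_append]
  · rfl
  · intro a ha
    exact (List.mem_append.1 ha).elim (h1.1 a) (h2.1 a)
  · rw [List.prod_append, h1.2, h2.2]

theorem IsHomogeneous.length_atom (hhom : 𝒢.IsHomogeneous) {a : G} (ha : a ∈ 𝒢.atoms) :
    𝒢.length a = 1 :=
  hhom.length_eq (l := [a]) ⟨by simpa using ha, by simp⟩ (𝒢.mem_divisors.1 ha.1).1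

theorem eq_one_of_length_eq_zero {x : G} (hx : x ∈ 𝒢.pos) (h : 𝒢.length x = 0) : x = 1 := by
  have := (𝒢.isAtomWord_atomWord hx).2
  rw [List.length_eq_zero_iff.1 h] at this
  simpa using this.symm

theorem IsHomogeneous.length_pow (hhom : 𝒢.IsHomogeneous) {x : G} (hx : x ∈ 𝒢.pos) (k : ℕ) :
    𝒢.length (x ^ k) = k * 𝒢.length x := by
  induction k with
  | zero => simp [hhom.length_one]
  | succ k ih => rw [pow_succ, hhom.length_mul (pow_mem hx k) hx, ih]; ring

theorem IsHomogeneous.length_le_of_prefix (hhom : 𝒢.IsHomogeneous) {x y : G} (hx : x ∈ 𝒢.pos)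
    (h : 𝒢.Prefix x y) : 𝒢.length x ≤ 𝒢.length y := by
  have := hhom.length_mul hx h
  rw [mul_inv_cancel_left] at this
  omega

theorem IsHomogeneous.eq_of_prefix_of_length_le (hhom : 𝒢.IsHomogeneous) {x y : G}
    (hx : x ∈ 𝒢.pos) (h : 𝒢.Prefix x y) (hl : 𝒢.length y ≤ 𝒢.length x) : x = y := by
  have := hhom.length_mul hx h
  rw [mul_inv_cancel_left] at this
  exact inv_mul_eq_one.1 (eq_one_of_length_eq_zero h (by omega))

variable (𝒢) in
/-- The homomorphism to `ℤ` extending the length of positive elements (see `ell_mul`). -/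
noncomputable def ell (x : G) : ℤ :=
  𝒢.length (𝒢.central ^ (exists_central_pow_mul_mem (𝒢 := 𝒢) x).choose * x) -
    𝒢.length (𝒢.central ^ (exists_central_pow_mul_mem (𝒢 := 𝒢) x).choose)

theorem IsHomogeneous.ell_eq (hhom : 𝒢.IsHomogeneous) {x : G} {n : ℕ}
    (h : 𝒢.central ^ n * x ∈ 𝒢.pos) :
    𝒢.ell x = 𝒢.length (𝒢.central ^ n * x) - 𝒢.length (𝒢.central ^ n) := by
  have key : ∀ m k : ℕ, 𝒢.central ^ m * x ∈ 𝒢.pos →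
      (𝒢.length (𝒢.central ^ (k + m) * x) : ℤ) - 𝒢.length (𝒢.central ^ (k + m)) =
        𝒢.length (𝒢.central ^ m * x) - 𝒢.length (𝒢.central ^ m) := by
    intro m k hm
    rw [pow_add, mul_assoc, hhom.length_mul (central_pow_mem k) hm,
      hhom.length_mul (central_pow_mem k) (central_pow_mem m)]
    push_cast
    ring
  have h0 := (exists_central_pow_mul_mem (𝒢 := 𝒢) x).choose_spec
  rw [ell, ← key _ n h0, ← key n (exists_central_pow_mul_mem (𝒢 := 𝒢) x).choose h,
    Nat.add_comm n]

theorem IsHomogeneous.ell_of_pos (hhom : 𝒢.IsHomogeneous) {x : G} (h : x ∈ 𝒢.pos) :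
    𝒢.ell x = 𝒢.length x := by
  rw [hhom.ell_eq (n := 0) (by simpa using h)]
  simp [hhom.length_one]

theorem IsHomogeneous.ell_mul (hhom : 𝒢.IsHomogeneous) (x y : G) :
    𝒢.ell (x * y) = 𝒢.ell x + 𝒢.ell y := by
  obtain ⟨n, hn⟩ := exists_central_pow_mul_mem (𝒢 := 𝒢) x
  obtain ⟨m, hm⟩ := exists_central_pow_mul_mem (𝒢 := 𝒢) y
  have e : 𝒢.central ^ (n + m) * (x * y) = (𝒢.central ^ n * x) * (𝒢.central ^ m * y) := by
    rw [mul_assoc (𝒢.central ^ n), ← mul_assoc x, central_pow_comm m x, pow_add]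
    simp only [mul_assoc]
  have hxy : 𝒢.central ^ (n + m) * (x * y) ∈ 𝒢.pos := by rw [e]; exact mul_mem hn hm
  rw [hhom.ell_eq hn, hhom.ell_eq hm, hhom.ell_eq hxy, e, hhom.length_mul hn hm, pow_add,
    hhom.length_mul (central_pow_mem n) (central_pow_mem m)]
  push_cast
  ring

theorem IsHomogeneous.ell_inv (hhom : 𝒢.IsHomogeneous) (x : G) : 𝒢.ell x⁻¹ = -𝒢.ell x := by
  have h := hhom.ell_mul x x⁻¹
  rw [mul_inv_cancel, hhom.ell_of_pos (one_mem _), hhom.length_one] at h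
  push_cast at h
  linarith

theorem IsHomogeneous.ell_conj (hhom : 𝒢.IsHomogeneous) (g x : G) :
    𝒢.ell (g * x * g⁻¹) = 𝒢.ell x := by
  rw [hhom.ell_mul, hhom.ell_mul, hhom.ell_inv]; ring

theorem IsHomogeneous.ell_le_length_leftNum (hhom : 𝒢.IsHomogeneous) (x : G) :
    𝒢.ell x ≤ 𝒢.length (𝒢.leftNum x) := by
  have h := hhom.ell_mul (𝒢.leftDen x) x
  rw [leftDen_mul, hhom.ell_of_pos (leftNum_mem x), hhom.ell_of_pos (leftDen_mem x)] at h
  have : (0 : ℤ) ≤ 𝒢.length (𝒢.leftDen x) := Int.natCast_nonneg _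
  linarith

/-- A positive element of `G_δ` dividing `Δ ^ k` is a product of `k` divisors of `δ`; so its length
is at most `k |δ|`, and it is divisible by `δ` unless it is shorter than that by at least `k`. -/
theorem DefinesStandard.length_bound {δ : G} (hδ : 𝒢.DefinesStandard δ)
    (hhom : 𝒢.IsHomogeneous) (k : ℕ) : ∀ x ∈ 𝒢.divMonoid δ, 𝒢.Prefix x (𝒢.Delta ^ k) →
      𝒢.length x ≤ k * 𝒢.length δ ∧
        (𝒢.Prefix δ x ∨ 𝒢.length x + k ≤ k * 𝒢.length δ) := by
  induction k with
  | zero =>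
    intro x hx h
    rw [𝒢.eq_one_of_mem_of_inv_mem (divMonoid_le_pos _ hx) (by simpa [Prefix] using h),
      hhom.length_one]
    simp
  | succ k ih =>
    intro x hx h
    obtain ⟨u, t, hu, hu', ht, rfl⟩ := exists_mul_simple (divMonoid_le_pos _ hx) h
    have htp := (𝒢.mem_divisors.1 ht).1
    obtain ⟨huδ, htδ⟩ := hδ.of_mul_mem hu htp hx
    have htd := hδ.mem_divisors_of_mem htδ ht
    obtain ⟨h1, h2⟩ := ih u huδ hu'
    have h3 := hhom.length_le_of_prefix htp (𝒢.mem_divisors.1 htd).2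
    rw [hhom.length_mul hu htp, Nat.add_mul, one_mul]
    refine ⟨by omega, ?_⟩
    rcases h2 with h2 | h2
    · exact Or.inl (h2.trans (prefix_mul_right htp))
    · by_cases h4 : 𝒢.length δ ≤ 𝒢.length t
      · left
        rw [hhom.eq_of_prefix_of_length_le htp (𝒢.mem_divisors.1 htd).2 h4]
        have := divMonoid_le_pos _ (hδ.1.conj_mem huδ)
        simpa [Prefix, mul_assoc] using this
      · right; omega

theorem prefix_Delta_pow {δ : G} (hδ : δ ∈ 𝒢.simples) (n : ℕ) :
    𝒢.Prefix (δ ^ n) (𝒢.Delta ^ n) := by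
  induction n with
  | zero => simp [Prefix, one_mem]
  | succ n ih =>
    have h := 𝒢.balanced_Delta.conj_mem (by rw [divMonoid_Delta]; exact ih)
    rw [divMonoid_Delta] at h
    have := mul_mem (𝒢.mem_divisors.1 hδ).2 h
    have e : δ⁻¹ * 𝒢.Delta * (𝒢.Delta⁻¹ * ((δ ^ n)⁻¹ * 𝒢.Delta ^ n) * 𝒢.Delta) =
        (δ ^ (n + 1))⁻¹ * 𝒢.Delta ^ (n + 1) := by
      rw [pow_succ δ, pow_succ 𝒢.Delta]; group
    rwa [e] at this

theorem central_pow_mul_conj (d g : G) (i j k : ℕ) :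
    𝒢.central ^ i * g⁻¹ * (d * 𝒢.central ^ j) * (𝒢.central ^ k * g) =
      g⁻¹ * d * g * 𝒢.central ^ (i + j + k) := by
  calc 𝒢.central ^ i * g⁻¹ * (d * 𝒢.central ^ j) * (𝒢.central ^ k * g)
      = g⁻¹ * (𝒢.central ^ i * d) * (𝒢.central ^ j * g) * 𝒢.central ^ k := by
        rw [← central_pow_comm i, ← central_pow_comm k]; simp only [mul_assoc]
    _ = g⁻¹ * d * (𝒢.central ^ i * g) * (𝒢.central ^ j * 𝒢.central ^ k) := by
        rw [← central_pow_comm i, ← central_pow_comm j]; simp only [mul_assoc]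
    _ = g⁻¹ * d * g * 𝒢.central ^ (i + j + k) := by
        rw [← central_pow_comm i, pow_add, pow_add]; simp only [mul_assoc]

/-- A parabolic subgroup of type `δ` contained in one of type `δ'` has `|δ| ≤ |δ'|`: compare the
growth of the powers of `δ` inside both groups. -/
theorem IsHomogeneous.length_le_of_conjSubgroup_le (hhom : 𝒢.IsHomogeneous) {δ δ' g : G}
    (hδ : 𝒢.DefinesStandard δ) (hδ' : 𝒢.DefinesStandard δ')
    (h : conjSubgroup (𝒢.parabolicOf δ) g ≤ 𝒢.parabolicOf δ') : 𝒢.length δ ≤ 𝒢.length δ' := by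
  obtain ⟨k, hk⟩ := exists_central_pow_mul_mem (𝒢 := 𝒢) g
  obtain ⟨k', hk'⟩ := exists_central_pow_mul_mem (𝒢 := 𝒢) g⁻¹
  set e := 𝒢.centralExp with he
  have he0 : 0 < e := centralExp_pos
  have key : ∀ j : ℕ, e * j * 𝒢.length δ ≤ e * (k' + j + k) * 𝒢.length δ' := by
    intro j
    set y := g⁻¹ * δ ^ (e * j) * g with hy
    have hyB : y ∈ 𝒢.parabolicOf δ' := by
      refine h (mem_conjSubgroup.2 ?_)
      have : g * y * g⁻¹ = δ ^ (e * j) := by rw [hy]; group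
      rw [this]
      exact pow_mem (hδ.divMonoid_subset_parabolicOf hδ.self_mem) _
    have h1 : (δ ^ (e * j))⁻¹ * 𝒢.central ^ j ∈ 𝒢.pos := by
      rw [central, ← pow_mul]
      exact prefix_Delta_pow hδ.2.1 (e * j)
    have h2 : 𝒢.central ^ (k' + j + k) * y⁻¹ ∈ 𝒢.pos := by
      have h3 := mul_mem (mul_mem hk' h1) hk
      rw [central_pow_mul_conj, central_pow_comm] at h3
      convert h3 using 2
      rw [hy]; group
    have h4 : 𝒢.Prefix (𝒢.leftNum y) (𝒢.Delta ^ (e * (k' + j + k))) := by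
      have := mul_leftDen_inv_mem (central_pow_mem _) h2
      rw [← central_pow_comm, leftDen_inv] at this
      rw [pow_mul]
      exact this
    have h5 := (hδ'.length_bound hhom _ _ (hδ'.leftNum_mem hyB) h4).1
    have h6 : 𝒢.ell y = (e * j * 𝒢.length δ : ℕ) := by
      have := hhom.ell_conj g⁻¹ (δ ^ (e * j))
      rw [inv_inv] at this
      rw [hy, this, hhom.ell_of_pos (pow_mem hδ.1.1 _), hhom.length_pow hδ.1.1]
    have h7 := hhom.ell_le_length_leftNum y
    rw [h6] at h7
    exact (Int.ofNat_le.1 h7).trans h5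
  by_contra hlt
  push Not at hlt
  have := key ((k' + k) * 𝒢.length δ' + 1)
  have h5 : e * ((k' + k) * 𝒢.length δ' + 1) * (𝒢.length δ' + 1) ≤
      e * ((k' + k) * 𝒢.length δ' + 1) * 𝒢.length δ := Nat.mul_le_mul_left _ hlt
  nlinarith

/-! ### Positive conjugates of full support -/

theorem exists_atom_prefix {c : G} (hc : c ∈ 𝒢.pos) (h1 : c ≠ 1) :
    ∃ s ∈ 𝒢.atoms, 𝒢.Prefix s c := by
  obtain ⟨hl, hp⟩ := 𝒢.isAtomWord_atomWord hc
  cases h : 𝒢.atomWord c with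
  | nil => rw [h] at hp; exact absurd hp.symm h1
  | cons s l =>
    rw [h] at hp hl
    refine ⟨s, hl s (by simp), ?_⟩
    rw [← hp, List.prod_cons]
    exact prefix_mul_right (𝒢.pos.list_prod_mem fun d hd =>
      (𝒢.mem_divisors.1 (hl d (by simp [hd])).1).1)

/-- Let `r` be positive with `δ r` simple, and let `u` be an atom dividing `δ` which `r` conjugates
to a positive element. As `δ r` is squarefree, `u` is not a prefix of `r`, and so the join of `u`
and `r` is `u r = r (r⁻¹ u r)`. -/
theorem IsSquarefree.prefix_of_prefix_atom_mul (hsq : 𝒢.IsSquarefree) (hhom : 𝒢.IsHomogeneous)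
    {δ r u k : G} (hδ : 𝒢.Balanced δ) (hr : r ∈ 𝒢.pos) (hδr : δ * r ∈ 𝒢.simples)
    (hu : u ∈ 𝒢.atoms) (huδ : u ∈ 𝒢.divisors δ) (hc : r⁻¹ * u * r ∈ 𝒢.pos) (hk : k ∈ 𝒢.pos)
    (h : 𝒢.Prefix r (u * k)) : 𝒢.Prefix r k := by
  have hup := (𝒢.mem_divisors.1 huδ).1
  obtain ⟨j, huj, hrj, hj⟩ := 𝒢.prefix_lattice.2.2.2.2 u r
  have hjr : 𝒢.Prefix j (u * r) :=
    hj _ (prefix_mul_right hr) (by simpa [Prefix, mul_assoc] using hc)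
  have hl : 𝒢.length (r⁻¹ * u * r) = 1 := by
    have h1 := hhom.ell_conj r⁻¹ u
    rw [inv_inv, hhom.ell_of_pos hc, hhom.ell_of_pos hup, hhom.length_atom hu] at h1
    exact_mod_cast h1
  have hl' := hhom.length_mul hrj hjr
  have e : r⁻¹ * j * (j⁻¹ * (u * r)) = r⁻¹ * u * r := by group
  rw [e, hl] at hl'
  rcases Nat.eq_zero_or_pos (𝒢.length (r⁻¹ * j)) with h0 | h0
  · exfalso
    have hjr' : r = j := inv_mul_eq_one.1 (eq_one_of_length_eq_zero hrj h0)
    rw [← hjr'] at huj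
    have h1 : (δ * u⁻¹) * ((u * u) * (u⁻¹ * r)) ∈ 𝒢.simples := by
      have : (δ * u⁻¹) * ((u * u) * (u⁻¹ * r)) = δ * r := by group
      rwa [this]
    have h2 := simples_of_mul_mem (hδ.mul_inv_mem huδ)
      (mul_mem (mul_mem hup hup) huj) h1
    exact hsq u hu (simples_of_mul_mem (mul_mem hup hup) huj h2.2).1
  · have h1 : j = u * r :=
      inv_mul_eq_one.1 (eq_one_of_length_eq_zero hjr (by omega))
    have h2 := hj _ (prefix_mul_right hk) h
    rw [h1] at h2
    simpa [Prefix, mul_assoc] using h2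

/-- Let `y` be a positive element of `G_δ` divisible by `δ = Δ_Y`, and let `g` be positive. If `g`
and `y g` have a common nontrivial prefix, then a nontrivial prefix `q` of `g` conjugates `y` to a
positive element: `q` is either an atom dividing `δ`, or the element `r` with
`δ r = Δ_{Y ∪ {s}}` for an atom `s` that does not divide `δ`. -/
theorem exists_prefix_conj_mem (hlcm : 𝒢.IsLCM) (hhom : 𝒢.IsHomogeneous) (hsq : 𝒢.IsSquarefree)
    {Y : Set G} (hY : Y ⊆ 𝒢.atoms) {y g c : G} (hy : y ∈ 𝒢.divMonoid (𝒢.deltaOf Y))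
    (hδy : 𝒢.Prefix (𝒢.deltaOf Y) y) (hg : g ∈ 𝒢.pos) (hc : c ∈ 𝒢.pos) (hc1 : c ≠ 1)
    (hcg : 𝒢.Prefix c g) (hcyg : 𝒢.Prefix c (y * g)) :
    ∃ q ∈ 𝒢.pos, q ≠ 1 ∧ 𝒢.Prefix q g ∧ q⁻¹ * y * q ∈ 𝒢.pos := by
  obtain ⟨s, hs, hsc⟩ := exists_atom_prefix hc hc1
  have hsp := (𝒢.mem_divisors.1 hs.1).1
  have hδ := hlcm.standard Y hY
  by_cases hsδ : 𝒢.Prefix s (𝒢.deltaOf Y)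
  · exact ⟨s, hsp, hs.2.1, hsc.trans hcg, mul_mem (hsδ.trans hδy) hsp⟩
  have hYs : insert s Y ⊆ 𝒢.atoms := Set.insert_subset hs hY
  have hT := hlcm.standard _ hYs
  have hTj := 𝒢.isJoin_deltaOf hYs
  have hYj := 𝒢.isJoin_deltaOf hY
  have hyp := divMonoid_le_pos _ hy
  have hδT : 𝒢.Prefix (𝒢.deltaOf Y) (𝒢.deltaOf (insert s Y)) :=
    hYj.2.2 _ hTj.1 fun x hx => hTj.2.1 x (Set.mem_insert_of_mem _ hx)
  have hTyg : 𝒢.Prefix (𝒢.deltaOf (insert s Y)) (y * g) := by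
    refine hTj.2.2 _ (mul_mem hyp hg) fun x hx => ?_
    rcases hx with rfl | hx
    · exact hsc.trans hcyg
    · exact (hYj.2.1 x hx).trans (hδy.trans (prefix_mul_right hg))
  set δ := 𝒢.deltaOf Y
  set T := 𝒢.deltaOf (insert s Y)
  set r := δ⁻¹ * T with hr
  have hδr : δ * r = T := by simp [hr]
  have hr1 : r ≠ 1 := by
    intro h
    refine hsδ ?_
    rw [inv_mul_eq_one.1 (hr.symm.trans h)]
    exact hTj.2.1 s (Set.mem_insert _ _)
  have hconj : ∀ u ∈ 𝒢.divisors δ, r⁻¹ * u * r ∈ 𝒢.pos := by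
    intro u hu
    have h1 := hδ.1.conj_inv_mem_divisors hu
    have h2 : δ * u * δ⁻¹ ∈ 𝒢.divisors T :=
      𝒢.mem_divisors.2 ⟨(𝒢.mem_divisors.1 h1).1, Prefix.trans (𝒢.mem_divisors.1 h1).2 hδT⟩
    have h3 := (𝒢.mem_divisors.1 (hT.1.conj_mem_divisors h2)).1
    simpa [hr, mul_assoc] using h3
  have hconj' : ∀ m ∈ 𝒢.divMonoid δ, r⁻¹ * m * r ∈ 𝒢.pos := by
    intro m hm
    induction hm using Submonoid.closure_induction with
    | mem u hu => exact hconj u hu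
    | one => simp [one_mem]
    | mul a b _ _ ha hb => simpa [mul_assoc] using mul_mem ha hb
  refine ⟨r, hδT, hr1, ?_, hconj' y hy⟩
  have hy' : δ⁻¹ * y ∈ 𝒢.divMonoid δ :=
    (hδ.of_mul_mem hδ.1.1 hδy (by simpa using hy)).2
  have hry : 𝒢.Prefix r (δ⁻¹ * y * g) := by
    have : 𝒢.Prefix T (y * g) := hTyg
    simpa [Prefix, hr, mul_assoc] using this
  -- As `r` is a prefix of `δ⁻¹ y g`, the atoms of `δ⁻¹ y` can be cancelled one by one.
  have key : ∀ l : List G, (∀ a ∈ l, a ∈ 𝒢.atoms) → (∀ a ∈ l, a ∈ 𝒢.divisors δ) →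
      𝒢.Prefix r (l.prod * g) → 𝒢.Prefix r g := by
    intro l
    induction l with
    | nil => intro _ _ h; simpa using h
    | cons u l ih =>
      intro hl hlδ h
      refine ih (fun a ha => hl a (by simp [ha])) (fun a ha => hlδ a (by simp [ha])) ?_
      have hu := hlδ u (by simp)
      refine hsq.prefix_of_prefix_atom_mul hhom hδ.1 hδT (by rw [hδr]; exact hT.2.1)
        (hl u (by simp)) hu (hconj u hu) ?_ (by simpa [mul_assoc] using h)
      exact mul_mem (𝒢.pos.list_prod_mem fun a ha =>
        (𝒢.mem_divisors.1 (hlδ a (by simp [ha]))).1) hg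
  have hw := 𝒢.isAtomWord_atomWord hδy
  exact key _ hw.1 (hδ.mem_divisors_of_mem_list hw.1 (by rw [hw.2]; exact hy'))
    (by rw [hw.2]; exact hry)

/-- If an iterated swap of `x` is positive and divisible by the `Δ_U` of its support, then the
conjugating element is the denominator of `x`. -/
theorem leftDen_eq_swapConj (hlcm : 𝒢.IsLCM) (hhom : 𝒢.IsHomogeneous) (hsq : 𝒢.IsSquarefree)
    {x : G} {k : ℕ} (hpos : 𝒢.swap^[k] x ∈ 𝒢.pos)
    (hpre : 𝒢.Prefix (𝒢.suppDelta (𝒢.swap^[k] x)) (𝒢.swap^[k] x)) :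
    𝒢.leftDen x = 𝒢.swapConj x k := by
  set y := 𝒢.swap^[k] x with hy
  set g := 𝒢.swapConj x k with hg
  have hgp : g ∈ 𝒢.pos := swapConj_mem x k
  have hyx : y = g * x * g⁻¹ := iterate_swap_eq x k
  have hyM : y ∈ 𝒢.divMonoid (𝒢.suppDelta y) :=
    (hlcm.suppDelta y).mem_divMonoid (hlcm.mem_parabolicOf_suppDelta y) hpos
  have hx : x = g⁻¹ * (y * g) := by rw [hyx]; group
  rw [leftDen, fraction_eq hgp (mul_mem hpos hgp) hx]
  intro c hc hcg hcyg
  by_contra hc1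
  obtain ⟨q, hq, hq1, hqg, hqy⟩ := exists_prefix_conj_mem hlcm hhom hsq (support_subset y) hyM
    hpre hgp hc hc1 hcg hcyg
  have h1 : (q⁻¹ * g) * x * (q⁻¹ * g)⁻¹ ∈ 𝒢.pos := by
    have : (q⁻¹ * g) * x * (q⁻¹ * g)⁻¹ = q⁻¹ * y * q := by rw [hyx]; group
    rwa [this]
  have h2 := mul_swapConj_inv_mem hqg h1 k
  rw [← hg, mul_inv_cancel_right] at h2
  exact hq1 (𝒢.eq_one_of_mem_of_inv_mem hq h2)

/-! ### The function maximized by the intersection -/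

theorem phi_eq_of_isConj {γ γ' : G} (h : IsConj γ γ') : 𝒢.phi γ = 𝒢.phi γ' := by
  have : 𝒢.recurrentConjugates γ = 𝒢.recurrentConjugates γ' := by
    ext y
    exact ⟨fun hy => ⟨h.symm.trans hy.1, hy.2⟩, fun hy => ⟨h.trans hy.1, hy.2⟩⟩
  rw [phi, phi, this]

theorem isConj_conj (g x : G) : IsConj x (g * x * g⁻¹) := isConj_iff.2 ⟨g, rfl⟩

theorem isConj_iterate_swap (x : G) (k : ℕ) : IsConj x (𝒢.swap^[k] x) := by
  rw [iterate_swap_eq]; exact isConj_conj _ _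

theorem recurrentConjugates_nonempty (γ : G) : (𝒢.recurrentConjugates γ).Nonempty :=
  let ⟨k, hk⟩ := exists_isRecurrent_iterate_swap (𝒢 := 𝒢) γ
  ⟨_, isConj_iterate_swap γ k, hk⟩

theorem IsSupportPreserving.phi_eq (hsupp : 𝒢.IsSupportPreserving) (hlcm : 𝒢.IsLCM)
    (hhom : 𝒢.IsHomogeneous) {γ y : G} (hy : y ∈ 𝒢.recurrentConjugates γ) :
    𝒢.phi γ = 𝒢.length (𝒢.suppDelta y) := by
  have h0 := Classical.epsilon_spec (p := fun y => y ∈ 𝒢.recurrentConjugates γ)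
    (recurrentConjugates_nonempty γ)
  have key : ∀ a b : G, 𝒢.IsRecurrent a → 𝒢.IsRecurrent b → IsConj a b →
      𝒢.length (𝒢.suppDelta a) ≤ 𝒢.length (𝒢.suppDelta b) := by
    intro a b ha hb hab
    obtain ⟨c, rfl⟩ := isConj_iff.1 hab
    exact hhom.length_le_of_conjSubgroup_le (hlcm.suppDelta _) (hlcm.suppDelta _)
      (hsupp.conjSubgroup_eq hlcm (α := c⁻¹) ha hb (by simp)).le
  have hc := h0.1.symm.trans hy.1
  exact le_antisymm (key _ _ h0.2 hy.2 hc) (key _ _ hy.2 h0.2 hc.symm)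

/-- A parabolic subgroup `G_δ ^ g` containing a recurrent element `x` and no larger than its
parabolic closure is equal to it. -/
theorem conjSubgroup_eq_of_length_le (hsupp : 𝒢.IsSupportPreserving) (hlcm : 𝒢.IsLCM)
    (hhom : 𝒢.IsHomogeneous) {δ x g : G} (hδ : 𝒢.DefinesStandard δ) (hx : 𝒢.IsRecurrent x)
    (hxg : x ∈ conjSubgroup (𝒢.parabolicOf δ) g)
    (hl : 𝒢.length δ ≤ 𝒢.length (𝒢.suppDelta x)) :
    conjSubgroup (𝒢.parabolicOf δ) g = 𝒢.parabolicOf (𝒢.suppDelta x) := by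
  obtain ⟨y, h, hh, hy, e⟩ := hδ.exists_conj_suppDelta hsupp hlcm hx hxg
  have hy' := 𝒢.mem_divisors.1 hy
  have h1 : 𝒢.length (𝒢.suppDelta x) ≤ 𝒢.length (𝒢.suppDelta y) := by
    refine hhom.length_le_of_conjSubgroup_le (g := (h * g)⁻¹) (hlcm.suppDelta x)
      (hlcm.suppDelta y) ?_
    rw [← e, conjSubgroup_conjSubgroup, mul_inv_cancel, conjSubgroup_of_mem (one_mem _)]
  have h2 : 𝒢.suppDelta y = δ := hhom.eq_of_prefix_of_length_le hy'.1 hy'.2 (hl.trans h1)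
  rw [h2, ← conjSubgroup_conjSubgroup, conjSubgroup_of_mem hh] at e
  exact e

/-- Let `β = w δ ^ (e n)`, where `Δ ^ e` is central and `n` is large. If `φ β ≤ |δ|`, then the
denominator of `β` conjugates `β` into a standard parabolic subgroup `G_U` with `|U| ≤ |δ|`. -/
theorem exists_mem_conjSubgroup_leftDen (hlcm : 𝒢.IsLCM) (hhom : 𝒢.IsHomogeneous)
    (hsupp : 𝒢.IsSupportPreserving) (hsq : 𝒢.IsSquarefree) {δ w : G}
    (hδ : 𝒢.DefinesStandard δ) : ∃ n₀ : ℕ, ∀ n ≥ n₀,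
      𝒢.phi (w * δ ^ (𝒢.centralExp * n)) ≤ 𝒢.length δ →
      ∃ U, 𝒢.DefinesStandard U ∧ 𝒢.length U ≤ 𝒢.length δ ∧
        w * δ ^ (𝒢.centralExp * n) ∈ conjSubgroup (𝒢.parabolicOf U)
          (𝒢.leftDen (w * δ ^ (𝒢.centralExp * n))) := by
  obtain ⟨q, hq⟩ := exists_central_pow_mul_mem (𝒢 := 𝒢) w⁻¹
  obtain ⟨p, hp⟩ := exists_central_pow_mul_mem (𝒢 := 𝒢) w
  set e := 𝒢.centralExp with he
  have he0 : 0 < e := centralExp_pos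
  refine ⟨e * q * 𝒢.length δ + (𝒢.ell w).natAbs + 1, fun n hn hphi => ?_⟩
  set x := w * δ ^ (e * n) with hx
  have hdn : δ ^ (e * n) ∈ 𝒢.pos := pow_mem hδ.1.1 _
  have hx1 : 𝒢.central ^ p * x ∈ 𝒢.pos := by
    rw [hx, ← mul_assoc]; exact mul_mem hp hdn
  have hx2 : x⁻¹ * 𝒢.central ^ (q + n) ∈ 𝒢.pos := by
    have h1 : (δ ^ (e * n))⁻¹ * 𝒢.central ^ n ∈ 𝒢.pos := by
      rw [central, ← pow_mul]
      exact prefix_Delta_pow hδ.2.1 (e * n)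
    have h2 := mul_mem h1 hq
    have : (δ ^ (e * n))⁻¹ * 𝒢.central ^ n * (𝒢.central ^ q * w⁻¹) =
        x⁻¹ * 𝒢.central ^ (q + n) := by
      rw [hx, mul_inv_rev, mul_assoc, mul_assoc, ← mul_assoc (𝒢.central ^ n), ← pow_add,
        ← central_pow_comm, Nat.add_comm]
    rwa [this] at h2
  obtain ⟨k, hk⟩ := exists_isRecurrent_iterate_swap (𝒢 := 𝒢) x
  set y := 𝒢.swap^[k] x with hy
  have hyx : y = 𝒢.swapConj x k * x * (𝒢.swapConj x k)⁻¹ := iterate_swap_eq x k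
  set U := 𝒢.suppDelta y with hU
  have hUs : 𝒢.DefinesStandard U := hlcm.suppDelta y
  have hUl : 𝒢.length U ≤ 𝒢.length δ := by
    rwa [hsupp.phi_eq hlcm hhom ⟨isConj_iterate_swap x k, hk⟩] at hphi
  have hyU : y ∈ 𝒢.parabolicOf U := hlcm.mem_parabolicOf_suppDelta y
  have hbnd : 𝒢.Prefix (𝒢.leftNum y) (𝒢.Delta ^ (e * (q + n))) := by
    have h1 := (iterate_swap_mem hx1 hx2 k).2
    rw [central_pow_comm] at h1
    have h2 := mul_leftDen_inv_mem (central_pow_mem _) h1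
    rw [← central_pow_comm, leftDen_inv] at h2
    rw [pow_mul]
    exact h2
  have hell : 𝒢.ell y = 𝒢.ell w + (e * n * 𝒢.length δ : ℕ) := by
    rw [hyx, hhom.ell_conj, hx, hhom.ell_mul, hhom.ell_of_pos hdn, hhom.length_pow hδ.1.1]
  -- The numerator of `y` is too long for a product of `e (q + n)` divisors of `U` other than `U`.
  have hUb : 𝒢.Prefix U (𝒢.leftNum y) := by
    refine ((hUs.length_bound hhom _ _ (hUs.leftNum_mem hyU) hbnd).2).resolve_right fun h => ?_
    have h1 := hhom.ell_le_length_leftNum y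
    rw [hell] at h1
    have h2 : e * (q + n) * 𝒢.length U ≤ e * (q + n) * 𝒢.length δ := Nat.mul_le_mul_left _ hUl
    have h3 : n ≤ e * (q + n) := by nlinarith
    have h4 : e * (q + n) * 𝒢.length δ = e * q * 𝒢.length δ + e * n * 𝒢.length δ := by ring
    omega
  have hden : 𝒢.leftDen y = 1 := by
    by_contra h1
    obtain ⟨s, hs, hsa⟩ := exists_atom_prefix (leftDen_mem y) h1
    have hsU := hUs.mem_divisors_of_prefix (hUs.leftDen_mem hyU) s hs.1 hsa
    exact hs.2.1 (eq_one_of_prefix_leftDen_leftNum (𝒢.mem_divisors.1 hsU).1 hsa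
      (Prefix.trans (𝒢.mem_divisors.1 hsU).2 hUb))
  have hynum : 𝒢.leftNum y = y := by rw [← leftDen_mul, hden, one_mul]
  rw [hynum] at hUb
  have hypos : y ∈ 𝒢.pos := by rw [← hynum]; exact leftNum_mem y
  refine ⟨U, hUs, hUl, mem_conjSubgroup.2 ?_⟩
  rw [leftDen_eq_swapConj hlcm hhom hsq hypos hUb, ← hyx]
  exact hyU

/-- Let the subgroup `I` contain the parabolic closure of a recurrent element `α`. If `φ` is bounded
on `I` by `φ α`, then `I` is that parabolic closure. -/
theorem eq_parabolicOf_of_phi_max (hlcm : 𝒢.IsLCM) (hhom : 𝒢.IsHomogeneous)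
    (hsupp : 𝒢.IsSupportPreserving) (hsq : 𝒢.IsSquarefree) {I : Subgroup G} {α : G}
    (hα : 𝒢.IsRecurrent α) (hI : 𝒢.parabolicOf (𝒢.suppDelta α) ≤ I)
    (hmax : ∀ β ∈ I, 𝒢.phi β ≤ 𝒢.phi α) : I = 𝒢.parabolicOf (𝒢.suppDelta α) := by
  refine le_antisymm (fun w hw => ?_) hI
  set δ := 𝒢.suppDelta α with hδα
  have hδ : 𝒢.DefinesStandard δ := hlcm.suppDelta α
  have hφ : 𝒢.phi α = 𝒢.length δ := hsupp.phi_eq hlcm hhom ⟨IsConj.refl α, hα⟩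
  have hδB : δ ∈ 𝒢.parabolicOf δ := hδ.divMonoid_subset_parabolicOf hδ.self_mem
  obtain ⟨n₀, hn₀⟩ := exists_mem_conjSubgroup_leftDen hlcm hhom hsupp hsq (w := w) hδ
  choose U hU hUl hUw using fun n : ℕ => hn₀ (n₀ + n) (by omega)
    (hφ ▸ hmax _ (mul_mem hw (hI (pow_mem hδB _))))
  set x : ℕ → G := fun n => w * δ ^ (𝒢.centralExp * (n₀ + n)) with hx
  obtain ⟨p, hp⟩ := exists_central_pow_mul_mem (𝒢 := 𝒢) w
  -- The conjugating elements are bounded independently of `n`, so some parabolic subgroup occurs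
  -- for two different exponents.
  have hfin : ∀ n, (𝒢.leftDen (x n), U n) ∈
      {c | c ∈ 𝒢.pos ∧ c⁻¹ * 𝒢.central ^ p ∈ 𝒢.pos} ×ˢ 𝒢.simples := by
    intro n
    refine ⟨⟨leftDen_mem _, ?_⟩, (hU n).2.1⟩
    rw [central_pow_comm]
    refine mul_leftDen_inv_mem (central_pow_mem p) ?_
    rw [hx, ← mul_assoc]
    exact mul_mem hp (pow_mem hδ.1.1 _)
  obtain ⟨i, j, hij, he⟩ := ((𝒢.finite_prefix_central_pow p).prod
    (𝒢.simples_finite.subset fun a ha => 𝒢.mem_divisors.1 ha)).exists_lt_map_eq_of_forall_mem hfin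
  obtain ⟨he1, he2⟩ := Prod.mk.inj he
  have hi : x i ∈ conjSubgroup (𝒢.parabolicOf (U i)) (𝒢.leftDen (x i)) := hUw i
  have hj : x j ∈ conjSubgroup (𝒢.parabolicOf (U i)) (𝒢.leftDen (x i)) := by
    rw [he1, he2]; exact hUw j
  have hk : 𝒢.centralExp * (j - i) ≠ 0 := (Nat.mul_pos centralExp_pos (by omega)).ne'
  have hpow : δ ^ (𝒢.centralExp * (j - i)) ∈
      conjSubgroup (𝒢.parabolicOf (U i)) (𝒢.leftDen (x i)) := by
    have := mul_mem (inv_mem hi) hj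
    have e : (x i)⁻¹ * x j = δ ^ (𝒢.centralExp * (j - i)) := by
      have : n₀ + j = (n₀ + i) + (j - i) := by omega
      simp only [hx]
      rw [this, mul_add, pow_add]
      group
    rwa [e] at this
  have hs := hlcm.suppDelta_pow hδ hk
  have heq := conjSubgroup_eq_of_length_le hsupp hlcm hhom (hU i)
    (isRecurrent_of_pos (pow_mem hδ.1.1 _)) hpow (by rw [hs]; exact hUl i)
  rw [hs] at heq
  rw [heq] at hi
  exact (Subgroup.mul_mem_cancel_right _ (pow_mem hδB _)).1 hi

end GarsideStructure

theorem mainTheorem7 {B : Type*} [Group B] (𝒢 : GarsideStructure B)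
    (hlcm : 𝒢.IsLCM) (hsupp : 𝒢.IsSupportPreserving)
    (hhom : 𝒢.IsHomogeneous) (hsq : 𝒢.IsSquarefree)
    (B₁ B₂ : Subgroup B) (h₁ : 𝒢.IsParabolic B₁) (h₂ : 𝒢.IsParabolic B₂) :
    𝒢.IsParabolic (B₁ ⊓ B₂) ∧
    (∃ α ∈ B₁ ⊓ B₂, ∀ β ∈ B₁ ⊓ B₂, 𝒢.phi β ≤ 𝒢.phi α) ∧
    (∀ α ∈ B₁ ⊓ B₂, (∀ β ∈ B₁ ⊓ B₂, 𝒢.phi β ≤ 𝒢.phi α) →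
      𝒢.IsParabolicClosure α (B₁ ⊓ B₂)) := by
  open GarsideStructure in
  have hmax : ∃ α ∈ B₁ ⊓ B₂, ∀ β ∈ B₁ ⊓ B₂, 𝒢.phi β ≤ 𝒢.phi α := by
    have hbdd : ∀ β, 𝒢.phi β ≤ 𝒢.length 𝒢.Delta := fun β => by
      have h := (hlcm.suppDelta (Classical.epsilon fun y => y ∈ 𝒢.recurrentConjugates β)).2.1
      exact hhom.length_le_of_prefix (𝒢.mem_divisors.1 h).1 (𝒢.mem_divisors.1 h).2
    have hfin : (𝒢.phi '' (B₁ ⊓ B₂ : Subgroup B)).Finite :=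
      (Set.finite_Iic (𝒢.length 𝒢.Delta)).subset (by rintro _ ⟨β, -, rfl⟩; exact hbdd β)
    obtain ⟨_, ⟨α, hα, rfl⟩, h⟩ := Set.exists_max_image _ id hfin ⟨_, 1, one_mem _, rfl⟩
    exact ⟨α, hα, fun β hβ => h _ ⟨β, hβ, rfl⟩⟩
  have hcl : ∀ α ∈ B₁ ⊓ B₂, (∀ β ∈ B₁ ⊓ B₂, 𝒢.phi β ≤ 𝒢.phi α) →
      𝒢.IsParabolicClosure α (B₁ ⊓ B₂) := by
    intro α hα hmaxα
    -- Conjugating by `c⁻¹` replaces `α` by a recurrent element `α'`.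
    obtain ⟨α', hconj, hrec⟩ := recurrentConjugates_nonempty (𝒢 := 𝒢) α
    obtain ⟨c, hc⟩ := isConj_iff.1 hconj
    have hmem : ∀ {Q : Subgroup B}, α ∈ Q → α' ∈ conjSubgroup Q c⁻¹ := fun hQ => by
      rw [mem_conjSubgroup, ← hc]
      simpa [mul_assoc] using hQ
    have hPC := hsupp.isParabolicClosure hlcm hrec
    have hI : conjSubgroup (B₁ ⊓ B₂) c⁻¹ = 𝒢.parabolicOf (𝒢.suppDelta α') := by
      refine eq_parabolicOf_of_phi_max hlcm hhom hsupp hsq hrec (fun x hx => ?_) fun β hβ => ?_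
      · have hx1 := mem_conjSubgroup.1 (hPC.2 ⟨h₁.conj c⁻¹, hmem hα.1⟩ hx)
        have hx2 := mem_conjSubgroup.1 (hPC.2 ⟨h₂.conj c⁻¹, hmem hα.2⟩ hx)
        exact mem_conjSubgroup.2 ⟨hx1, hx2⟩
      · rw [phi_eq_of_isConj (isConj_conj c⁻¹ β), ← phi_eq_of_isConj hconj]
        exact hmaxα _ (mem_conjSubgroup.1 hβ)
    have hback : ∀ Q : Subgroup B, conjSubgroup (conjSubgroup Q c⁻¹) c = Q := fun Q => by
      rw [conjSubgroup_conjSubgroup, inv_mul_cancel, conjSubgroup_of_mem (one_mem _)]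
    refine ⟨⟨?_, hα⟩, fun Q hQ => ?_⟩
    · rw [← hback (B₁ ⊓ B₂), hI]
      exact hPC.1.1.conj c
    · rw [← hback (B₁ ⊓ B₂), hI, ← hback Q]
      exact conjSubgroup_mono (hPC.2 ⟨hQ.1.conj c⁻¹, hmem hQ.2⟩) c
  obtain ⟨α, hα, h⟩ := hmax
  exact ⟨(hcl α hα h).1.1, ⟨α, hα, h⟩, hcl⟩
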